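/- \textbf{Setting.} For a smooth convex embedding $Y:S^2\to\mathbb R^3$ with outward unit normal $\vec n$ and positive principal curvatures let $r_1\ge r_2>0$ be its radii of curvature (the reciprocals of the principal curvatures), and put $\psi=\frac12(r_1+r_2)$, $|\sigma|=\frac12(r_1-r_2)$. The pair $(\psi,|\sigma|)$ takes values in $\Omega=\{(\psi,|\sigma|): 0\le|\sigma|<\psi\}$, a part of the closed upper half-plane $\mathbb R^2_+$. For $C^2$ functions $\mathcal F,\mathcal G:\Omega\to\mathbb R$ write $\mathcal F_{10}=\partial\mathcal F/\partial\psi$, $\mathcal F_{01}=\partial\mathcal F/\partial|\sigma|$ (one-sided on $|\sigma|=0$), $\mathrm{Hess}(\mathcal F)$ for the $2\times2$ matrix of second partial derivatives, and $\{\mathcal F,\mathcal G\}=\mathcal F_{10}\mathcal G_{01}-\mathcal F_{01}\mathcal G_{10}$. Let $\mathcal K:\Omega\to\mathbb R$ be $C^2$ and let $\vec X:S^2\times[0,t_1)\to\mathbb R^3$, $t_1>0$, be a classical curvature flow: a smooth 1-parameter family of such convex embeddings with $$\Big(\frac{\partial\vec X}{\partial t}\Big)^{\perp}=-\mathcal K(\psi,|\sigma|)\,\vec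 n ,$$ where $\perp$ denotes the component normal to the surface. Let $f_t:S^2\to\Omega$ be the map $p\mapsto(\psi,|\sigma|)$ of the surface $\vec X(\cdot,t)$. \textbf{Theorem 1.} Suppose that the flow is parabolic: $-\mathcal K_{10}>|\mathcal K_{01}|$ on $\Omega$. (1) If the flow is contracting, $\mathcal K\ge0$, and $\mathcal K$ is convex, $\mathrm{Hess}(\mathcal K)\ge0$, then for every $C^2$ function $\mathcal H:\Omega\to\mathbb R$ with (a) $\mathcal H_{10}\ge|\mathcal H_{01}|$, (b) $\mathrm{Hess}(\mathcal H)\ge0$, (c) $\{\mathcal H,\mathcal K\}\ge0$, $$\mathcal H\circ f_t\le\max_{S^2}\mathcal H\circ f_0\qquad\text{on } S^2\text{ for all }t\in[0,t_1).$$ (2) If the flow is expanding, $\mathcal K\le0$, and $\mathcal K$ is concave, $\mathrm{Hess}(\mathcal K)\le0$, then for every $C^2$ function $\mathcal H:\Omega\to\mathbb R$ with (a) $\mathcal H_{10}\ge|\mathcal H_{01}|$, (b) $\mathrm{Hess}(\mathcal H)\le0$, (c) $\{\mathcal H,\mathcal K\}\le0$, $$\mathcal H\circ f_t\ge\min_{S^2}\mathcal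 H\circ f_0\qquad\text{on } S^2\text{ for all }t\in[0,t_1).$$ (In both parts the conditions are imposed at all points of $\Omega$.) -/

import Mathlib

open Set
open scoped Manifold ContDiff

noncomputable section

namespace CurvatureFlow

/-- Euclidean 3-space. -/
abbrev E3 : Type := EuclideanSpace ℝ (Fin 3)

/-- The unit 2-sphere with its standard smooth structure. -/
abbrev S2 : Type := Metric.sphere (0 : E3) 1

/-! ### Convex surfaces and their radii of curvature -/

/-- The differential at `p` of a map `Y : S² → ℝ³`. -/
abbrev diffAt (Y : S2 → E3) (p : S2) : TangentSpace (𝓡 2) p →L[ℝ] E3 :=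
  mvfderiv (𝓡 2) Y p

/-- `Y : S² → ℝ³` is a smooth convex embedding with outward unit normal `N`: the image lies on one
side of each of its tangent planes, `N` points to the other side, and the second fundamental form
`⟨dY, dN⟩` is positive definite (so that the Gauss map `N` is a local diffeomorphism and the radii
of curvature are finite). -/
structure IsConvexEmbedding (Y N : S2 → E3) : Prop where
  smooth : ContMDiff (𝓡 2) 𝓘(ℝ, E3) ∞ Y
  injective : Function.Injective Y
  immersion : ∀ p, Function.Injective (diffAt Y p)
  norm_normal : ∀ p, ‖N p‖ = 1
  normal_orthogonal : ∀ p v, inner ℝ (diffAt Y p v) (N p) = 0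
  convex : ∀ p q, inner ℝ (Y q - Y p) (N p) ≤ 0
  secondFundamentalForm_pos : ∀ p v, v ≠ 0 → 0 < inner ℝ (diffAt Y p v) (diffAt N p v)

/-- The radii of curvature at `p`: the numbers `r` with `dY v = r dN v` for some principal direction
`v ≠ 0` (Rodrigues), that is, the reciprocals of the principal curvatures. -/
def radiiOfCurvature (Y N : S2 → E3) (p : S2) : Set ℝ :=
  {r | ∃ v : TangentSpace (𝓡 2) p, v ≠ 0 ∧ diffAt Y p v = r • diffAt N p v}

/-- The larger radius of curvature `r₁`. -/
def r₁ (Y N : S2 → E3) (p : S2) : ℝ := sSup (radiiOfCurvature Y N p)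

/-- The smaller radius of curvature `r₂`. -/
def r₂ (Y N : S2 → E3) (p : S2) : ℝ := sInf (radiiOfCurvature Y N p)

/-- The radii of curvature diagram `p ↦ (ψ, |σ|) = ((r₁ + r₂) / 2, (r₁ - r₂) / 2)`. -/
def rocDiagram (Y N : S2 → E3) (p : S2) : ℝ × ℝ :=
  ((r₁ Y N p + r₂ Y N p) / 2, (r₁ Y N p - r₂ Y N p) / 2)

/-! ### Calculus on radii of curvature space -/

/-- The part of the closed upper half-plane of pairs `(ψ, |σ|)` with `r₁ ≥ r₂ > 0`. Umbilic points
correspond to the boundary `|σ| = 0`, where derivatives are taken from inside. -/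
def rocSpace : Set (ℝ × ℝ) := {x | 0 ≤ x.2 ∧ x.2 < x.1}

/-- `F₁₀ = ∂F/∂ψ`. -/
def d10 (F : ℝ × ℝ → ℝ) (x : ℝ × ℝ) : ℝ := fderivWithin ℝ F rocSpace x (1, 0)

/-- `F₀₁ = ∂F/∂|σ|`. -/
def d01 (F : ℝ × ℝ → ℝ) (x : ℝ × ℝ) : ℝ := fderivWithin ℝ F rocSpace x (0, 1)

/-- The Hessian matrix of `F`. -/
def hess (F : ℝ × ℝ → ℝ) (x : ℝ × ℝ) : Matrix (Fin 2) (Fin 2) ℝ :=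
  !![d10 (d10 F) x, d10 (d01 F) x; d10 (d01 F) x, d01 (d01 F) x]

/-- The Poisson bracket in the canonical coordinates `(ψ, |σ|)`. -/
def poisson (F G : ℝ × ℝ → ℝ) (x : ℝ × ℝ) : ℝ := d10 F x * d01 G x - d01 F x * d10 G x

/-! ### Classical curvature flows -/

/-- A classical curvature flow on `[0, t₁)`: a smooth 1-parameter family of smooth convex embeddings
`X t`, with outward unit normals `N t`, such that `(∂X/∂t)^⊥ = -K(ψ, |σ|) N`. -/
structure IsClassicalCurvatureFlow (K : ℝ × ℝ → ℝ) (t₁ : ℝ) (X N : ℝ → S2 → E3) : Prop where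
  smooth : ContMDiffOn (𝓘(ℝ, ℝ).prod (𝓡 2)) 𝓘(ℝ, E3) ∞
    (fun q : ℝ × S2 => X q.1 q.2) (Ico 0 t₁ ×ˢ univ)
  convexEmbedding : ∀ t ∈ Ico 0 t₁, IsConvexEmbedding (X t) (N t)
  normal_velocity : ∀ t ∈ Ico 0 t₁, ∀ p,
    inner ℝ (derivWithin (fun τ => X τ p) (Ico 0 t₁) t) (N t p) • N t p
      = -K (rocDiagram (X t) (N t) p) • N t p

end CurvatureFlow

end

noncomputable section

namespace CurvatureFlow

open Filter Topology

/-! ### The gradient inequality on radii of curvature space -/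

/-! The proof is a maximum principle at a point of first contact. If `H ∘ f_t` ever exceeded its
initial maximum, then for a small `ε > 0` the function `H ∘ f_t - ε t` would have a space-time
maximum on a compact time interval at some `t₀ > 0` (`exists_isGreatest_forall_le`). The obstacle is
that `r₁`, `r₂` need not be differentiable at umbilic points, so second derivatives of `H ∘ f_t` are
unavailable.

The remedy is to differentiate only the support function `w(t, z) = ⟨x, z⟩`, homogeneous in the
normal direction `z`. It satisfies `∂ₜw = -‖z‖ K`, and `‖z‖ D²w` on the complement of `z` has
eigenvalues `r₁ ≥ r₂` (`exists_support_function`, `exists_support_frame`). Fix the principal frame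
`e₁, e₂` of the contact point and let `A`, `C` be the second derivatives of `w` along `e₁`, `e₂`. At
the contact point they are `r₁`, `r₂`; nearby, Rayleigh quotients bound them by the radii.

The Hessian conditions enter only through tangent-plane inequalities at the contact point. Write
`aᵢ`, `kᵢ` for the derivatives of `H`, `K` in `rᵢ` there, and `b = a₂k₁ - a₁k₂ = {H, K}/2 ≥ 0`.
Moving the normal towards `e₁`, a combination of the two tangent-plane inequalities eliminates `r₁`
and shows that `a₁K + b r₂` is smallest at the contact; since `b ≥ 0`, the smooth `‖z‖C ≥ r₂` may
replace `r₂`. Moving towards `e₂`, the same works for `a₂K - b r₁`. Adding the two second-derivative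
tests cancels the mixed fourth derivatives of `w` and leaves `a₁∂ₜA + a₂∂ₜC ≤ -(a₁ + a₂)K - b(r₁ -
r₂) ≤ 0`, whereas comparison in time makes the left side at least `ε`. This contradiction is
`not_first_contact`. The concave case is the same statement for `-w`, which interchanges the roles
of the two radii. -/

theorem convex_rocSpace : Convex ℝ rocSpace := by
  rintro x ⟨hx0, hx1⟩ y ⟨hy0, hy1⟩ a b ha hb hab
  refine ⟨?_, ?_⟩
  · simp only [Prod.snd_add, Prod.smul_snd, smul_eq_mul]
    positivity
  · simp only [Prod.snd_add, Prod.smul_snd, smul_eq_mul, Prod.fst_add, Prod.smul_fst]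
    rcases ha.eq_or_lt with rfl | ha'
    · simp only [zero_add] at hab
      subst hab
      linarith
    · nlinarith [mul_lt_mul_of_pos_left hx1 ha', mul_le_mul_of_nonneg_left hy1.le hb]

theorem interior_rocSpace_nonempty : (interior rocSpace).Nonempty := by
  have ho : IsOpen {x : ℝ × ℝ | 0 < x.2 ∧ x.2 < x.1} :=
    (isOpen_lt continuous_const continuous_snd).inter (isOpen_lt continuous_snd continuous_fst)
  have hs : {x : ℝ × ℝ | 0 < x.2 ∧ x.2 < x.1} ⊆ rocSpace := fun x hx => ⟨hx.1.le, hx.2⟩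
  exact ⟨(2, 1), interior_maximal hs ho (by simp)⟩

theorem uniqueDiffOn_rocSpace : UniqueDiffOn ℝ rocSpace :=
  uniqueDiffOn_convex convex_rocSpace interior_rocSpace_nonempty

/-- A `C²` function on a convex set whose second derivative is nonnegative in the direction of
`y - x` lies above its linearization at `x`. -/
theorem fderivWithin_apply_sub_le {E : Type*} [NormedAddCommGroup E] [NormedSpace ℝ E] {s : Set E}
    (hs : Convex ℝ s) (hu : UniqueDiffOn ℝ s) {F : E → ℝ} (hF : ContDiffOn ℝ 2 F s) {x y : E}
    (hx : x ∈ s) (hy : y ∈ s)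
    (h2 : ∀ z ∈ s, 0 ≤ fderivWithin ℝ (fderivWithin ℝ F s) s z (y - x) (y - x)) :
    fderivWithin ℝ F s x (y - x) ≤ F y - F x := by
  set w := y - x with hw
  set γ : ℝ → E := fun τ => x + τ • w with hγ
  have hmaps : MapsTo γ (Icc 0 1) s := fun τ hτ => hs.add_smul_sub_mem hx hy hτ
  have hγd : ∀ τ, HasDerivWithinAt γ w (Icc 0 1) τ := fun τ => by
    have : HasDerivAt γ w τ := by
      simpa [hγ] using ((hasDerivAt_id τ).smul_const w).const_add x
    exact this.hasDerivWithinAt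
  have h1 : ∀ τ ∈ Icc (0 : ℝ) 1,
      HasDerivWithinAt (fun τ => F (γ τ)) (fderivWithin ℝ F s (γ τ) w) (Icc 0 1) τ := fun τ hτ =>
    ((hF.differentiableOn two_ne_zero) _ (hmaps hτ)).hasFDerivWithinAt.comp_hasDerivWithinAt τ
      (hγd τ) hmaps
  have h1' : ∀ τ ∈ Icc (0 : ℝ) 1,
      HasDerivWithinAt (fun τ => fderivWithin ℝ F s (γ τ) w)
        (fderivWithin ℝ (fderivWithin ℝ F s) s (γ τ) w w) (Icc 0 1) τ := fun τ hτ => by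
    have := (((hF.fderivWithin hu (m := 1) (by norm_num)).differentiableOn one_ne_zero) _
      (hmaps hτ)).hasFDerivWithinAt.comp_hasDerivWithinAt τ (hγd τ) hmaps
    simpa using this.clm_apply (hasDerivWithinAt_const τ (Icc (0:ℝ) 1) w)
  have hmono : MonotoneOn (fun τ => fderivWithin ℝ F s (γ τ) w) (Icc 0 1) := by
    refine monotoneOn_of_hasDerivWithinAt_nonneg (convex_Icc 0 1)
      (fun τ hτ => (h1' τ hτ).continuousWithinAt)
      (fun τ hτ => (h1' τ (interior_subset hτ)).mono interior_subset) fun τ hτ => ?_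
    exact h2 _ (hmaps (interior_subset hτ))
  -- The mean value theorem turns the increment of `F` into the slope at an interior parameter,
  -- which monotonicity bounds below by the slope at `0`.
  obtain ⟨c, hc, hceq⟩ := exists_hasDerivAt_eq_slope (fun τ => F (γ τ))
    (fun τ => fderivWithin ℝ F s (γ τ) w) one_pos (fun τ hτ => (h1 τ hτ).continuousWithinAt)
    (fun τ hτ => (h1 τ (Ioo_subset_Icc_self hτ)).hasDerivAt (Icc_mem_nhds hτ.1 hτ.2))
  have := hmono (left_mem_Icc.2 zero_le_one) (Ioo_subset_Icc_self hc) hc.1.le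
  simp only [hceq] at this
  simpa [hγ, hw] using this

theorem fderivWithin_fderivWithin_rocSpace {F : ℝ × ℝ → ℝ} (hF : ContDiffOn ℝ 2 F rocSpace)
    {z : ℝ × ℝ} (hz : z ∈ rocSpace) (w : ℝ × ℝ) :
    fderivWithin ℝ (fderivWithin ℝ F rocSpace) rocSpace z w w =
      w.1 * w.1 * hess F z 0 0 + w.1 * w.2 * hess F z 0 1 + w.2 * w.1 * hess F z 1 0 +
        w.2 * w.2 * hess F z 1 1 := by
  have hd : DifferentiableWithinAt ℝ (fderivWithin ℝ F rocSpace) rocSpace z :=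
    (hF.fderivWithin uniqueDiffOn_rocSpace (m := 1) (by norm_num)).differentiableOn one_ne_zero _ hz
  have key : ∀ e v : ℝ × ℝ, fderivWithin ℝ (fun x => fderivWithin ℝ F rocSpace x e) rocSpace z v =
      fderivWithin ℝ (fderivWithin ℝ F rocSpace) rocSpace z v e := fun e v => by
    rw [fderivWithin_clm_apply (uniqueDiffOn_rocSpace z hz) hd (differentiableWithinAt_const e)]
    simp [fderivWithin_const_apply]
  -- Mixed derivatives commute also on the umbilic boundary, because a convex set with nonempty
  -- interior lies in the closure of that interior.
  have hsymm : IsSymmSndFDerivWithinAt ℝ F rocSpace z :=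
    (hF z hz).isSymmSndFDerivWithinAt (by simp) uniqueDiffOn_rocSpace
      (by
        rw [convex_rocSpace.closure_interior_eq_closure_of_nonempty_interior
          interior_rocSpace_nonempty]
        exact subset_closure hz) hz
  have hw : w = w.1 • ((1, 0) : ℝ × ℝ) + w.2 • ((0, 1) : ℝ × ℝ) := by simp
  simp only [hess, d10, d01, Matrix.of_apply, Matrix.cons_val', Matrix.cons_val_zero,
    Matrix.cons_val_one, Matrix.empty_val', Matrix.cons_val_fin_one]
  change _ = w.1 * w.1 * fderivWithin ℝ (fun x => fderivWithin ℝ F rocSpace x (1, 0)) rocSpace z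
    (1, 0) + w.1 * w.2 * fderivWithin ℝ (fun x => fderivWithin ℝ F rocSpace x (0, 1)) rocSpace z
    (1, 0) + w.2 * w.1 * fderivWithin ℝ (fun x => fderivWithin ℝ F rocSpace x (0, 1)) rocSpace z
    (1, 0) + w.2 * w.2 * fderivWithin ℝ (fun x => fderivWithin ℝ F rocSpace x (0, 1)) rocSpace z
    (0, 1)
  rw [key, key, key]
  conv_lhs => rw [hw]
  simp only [map_add, map_smul, add_apply, smul_apply,
    smul_eq_mul]
  rw [hsymm (0, 1) (1, 0)]
  ring

theorem fderivWithin_rocSpace_apply (F : ℝ × ℝ → ℝ) (x w : ℝ × ℝ) :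
    fderivWithin ℝ F rocSpace x w = d10 F x * w.1 + d01 F x * w.2 := by
  have hw : w = w.1 • ((1, 0) : ℝ × ℝ) + w.2 • ((0, 1) : ℝ × ℝ) := by simp
  conv_lhs => rw [hw]
  simp only [map_add, map_smul, smul_eq_mul, d10, d01]
  ring

theorem quadratic_nonneg_of_posSemidef {A : Matrix (Fin 2) (Fin 2) ℝ} (hA : A.PosSemidef)
    (a b : ℝ) : 0 ≤ a * a * A 0 0 + a * b * A 0 1 + b * a * A 1 0 + b * b * A 1 1 := by
  have := hA.dotProduct_mulVec_nonneg ![a, b]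
  simp [Matrix.mulVec, dotProduct, Fin.sum_univ_two] at this
  linarith

/-- A function with nonnegative Hessian lies above its tangent planes. -/
theorem le_sub_of_hess_posSemidef {F : ℝ × ℝ → ℝ} (hF : ContDiffOn ℝ 2 F rocSpace)
    (h : ∀ x ∈ rocSpace, (hess F x).PosSemidef) {x y : ℝ × ℝ} (hx : x ∈ rocSpace)
    (hy : y ∈ rocSpace) :
    d10 F x * (y.1 - x.1) + d01 F x * (y.2 - x.2) ≤ F y - F x := by
  have := fderivWithin_apply_sub_le convex_rocSpace uniqueDiffOn_rocSpace hF hx hy fun z hz => by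
    rw [fderivWithin_fderivWithin_rocSpace hF hz]
    exact quadratic_nonneg_of_posSemidef (h z hz) _ _
  rwa [fderivWithin_rocSpace_apply] at this

/-- A function with nonpositive Hessian lies below its tangent planes. -/
theorem sub_le_of_neg_hess_posSemidef {F : ℝ × ℝ → ℝ} (hF : ContDiffOn ℝ 2 F rocSpace)
    (h : ∀ x ∈ rocSpace, (-hess F x).PosSemidef) {x y : ℝ × ℝ} (hx : x ∈ rocSpace)
    (hy : y ∈ rocSpace) :
    F y - F x ≤ d10 F x * (y.1 - x.1) + d01 F x * (y.2 - x.2) := by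
  have h1 : ∀ z ∈ rocSpace,
      fderivWithin ℝ (fun z => -F z) rocSpace z = -fderivWithin ℝ F rocSpace z :=
    fun z hz => fderivWithin_fun_neg (uniqueDiffOn_rocSpace z hz)
  have := fderivWithin_apply_sub_le convex_rocSpace uniqueDiffOn_rocSpace hF.neg hx hy
    fun z hz => by
      have h2 : fderivWithin ℝ (fderivWithin ℝ (fun z => -F z) rocSpace) rocSpace z =
          -fderivWithin ℝ (fderivWithin ℝ F rocSpace) rocSpace z := by
        rw [fderivWithin_congr h1 (h1 z hz)]
        exact fderivWithin_fun_neg (uniqueDiffOn_rocSpace z hz)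
      rw [h2]
      have := quadratic_nonneg_of_posSemidef (h z hz) (y - x).1 (y - x).2
      simp only [neg_apply, Matrix.neg_apply] at this ⊢
      rw [fderivWithin_fderivWithin_rocSpace hF hz]
      linarith
  rw [h1 x hx, neg_apply, fderivWithin_rocSpace_apply] at this
  simp only [Prod.fst_sub, Prod.snd_sub] at this
  linarith

/-! ### Second derivatives along lines -/

section DirDeriv

/-- The second derivative is nonnegative at a local minimum. -/
theorem second_deriv_nonneg_of_isLocalMin {f f' : ℝ → ℝ} {x c : ℝ} (hmin : IsLocalMin f x)
    (h1 : ∀ᶠ y in 𝓝 x, HasDerivAt f (f' y) y) (h2 : HasDerivAt f' c x) : 0 ≤ c := by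
  by_contra! hc
  have hd : deriv f =ᶠ[𝓝 x] f' := h1.mono fun y hy => hy.deriv
  have hdd : deriv (deriv f) x = c := by rw [hd.deriv_eq, h2.deriv]
  -- With `c < 0` the point would also be a local maximum, so `f` would be locally constant and its
  -- second derivative zero.
  have hmax := isLocalMax_of_deriv_deriv_neg (hdd ▸ hc) hmin.deriv_eq_zero
    h1.self_of_nhds.continuousAt
  have hconst : f =ᶠ[𝓝 x] fun _ => f x :=
    hmin.and hmax |>.mono fun y hy => le_antisymm hy.2 hy.1
  have : deriv f =ᶠ[𝓝 x] deriv fun _ => f x := hconst.deriv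
  rw [this.deriv_eq] at hdd
  simp at hdd
  linarith

variable {E : Type*} [NormedAddCommGroup E] [NormedSpace ℝ E]

/-- The derivative of `F` in the fixed direction `v`, as a function. -/
def dirDeriv (v : E) (F : E → ℝ) : E → ℝ := fun z => fderiv ℝ F z v

theorem contDiffOn_dirDeriv {U : Set E} (hU : IsOpen U) {F : E → ℝ} {m n : WithTop ℕ∞}
    (hF : ContDiffOn ℝ n F U) (hmn : m + 1 ≤ n) (v : E) : ContDiffOn ℝ m (dirDeriv v F) U :=
  (hF.fderiv_of_isOpen hU hmn).clm_apply contDiffOn_const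

theorem dirDeriv_congr {U : Set E} (hU : IsOpen U) {F G : E → ℝ} (h : EqOn F G U) (v : E) :
    EqOn (dirDeriv v F) (dirDeriv v G) U := fun z hz => by
  have : F =ᶠ[𝓝 z] G := h.eventuallyEq_of_mem (hU.mem_nhds hz)
  simp only [dirDeriv, this.fderiv_eq]

theorem dirDeriv_dirDeriv {U : Set E} (hU : IsOpen U) {F : E → ℝ} (hF : ContDiffOn ℝ 2 F U)
    (v w : E) {z : E} (hz : z ∈ U) :
    dirDeriv v (dirDeriv w F) z = fderiv ℝ (fderiv ℝ F) z v w := by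
  have : DifferentiableAt ℝ (fderiv ℝ F) z :=
    ((hF.fderiv_of_isOpen hU (m := 1) (by norm_num)).differentiableOn one_ne_zero).differentiableAt
      (hU.mem_nhds hz)
  change fderiv ℝ (fun y => fderiv ℝ F y w) z v = _
  rw [fderiv_clm_apply this (differentiableAt_const w)]
  simp

theorem dirDeriv_comm {U : Set E} (hU : IsOpen U) {F : E → ℝ} (hF : ContDiffOn ℝ 2 F U) (v w : E) :
    EqOn (dirDeriv v (dirDeriv w F)) (dirDeriv w (dirDeriv v F)) U := fun z hz => by
  rw [dirDeriv_dirDeriv hU hF v w hz, dirDeriv_dirDeriv hU hF w v hz]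
  exact (hF.contDiffAt (hU.mem_nhds hz)).isSymmSndFDerivAt (by simp) v w

theorem hasDerivAt_line {F : E → ℝ} {x v : E} {s : ℝ} (hF : DifferentiableAt ℝ F (x + s • v)) :
    HasDerivAt (fun s : ℝ => F (x + s • v)) (dirDeriv v F (x + s • v)) s := by
  have h : HasDerivAt (fun s : ℝ => x + s • v) v s := by
    simpa using ((hasDerivAt_id s).smul_const v).const_add x
  exact hF.hasFDerivAt.comp_hasDerivAt s h

end DirDeriv

/-! ### The maximum principle at a point of first contact -/

/-- First contact gives information only for times up to `t₀`. Dividing by the negative `t - t₀`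
turns the upper bound on increments into a lower bound on left difference quotients. -/
theorem le_deriv_of_le_left {g : ℝ → ℝ} {t₀ c ε : ℝ} (hg : HasDerivAt g c t₀)
    (h : ∀ᶠ t in 𝓝 t₀, t ≤ t₀ → g t - g t₀ ≤ ε * (t - t₀)) : ε ≤ c := by
  have hlim : Tendsto (slope g t₀) (𝓝[<] t₀) (𝓝 c) :=
    (hasDerivAt_iff_tendsto_slope.1 hg).mono_left
      (nhdsWithin_mono _ fun t (ht : t < t₀) => ht.ne)
  refine ge_of_tendsto hlim ?_
  filter_upwards [nhdsWithin_le_nhds h, self_mem_nhdsWithin] with t ht htlt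
  have htlt : t < t₀ := htlt
  rw [slope_def_field, le_div_iff_of_neg (by linarith)]
  exact ht htlt.le

/-- This is the second-derivative test at `s = 0`, where both sides agree. The corrections `-W 0`
and `+Q 0` arise from the second derivatives `1` of `√(1 + s²)` and `2` of `1 + s²`. -/
theorem second_deriv_nonneg_of_sqrt_le {W Q W' Q' : ℝ → ℝ} {W'' Q'' α β : ℝ}
    (hW : ∀ᶠ s in 𝓝 0, HasDerivAt W (W' s) s) (hW' : HasDerivAt W' W'' 0)
    (hQ : ∀ᶠ s in 𝓝 0, HasDerivAt Q (Q' s) s) (hQ' : HasDerivAt Q' Q'' 0)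
    (h : ∀ᶠ s in 𝓝 0, (α * W 0 + β * Q 0) * √(1 + s ^ 2) ≤ α * W s + β * ((1 + s ^ 2) * Q s)) :
    0 ≤ α * (W'' - W 0) + β * (Q 0 + Q'') := by
  set f₀ := α * W 0 + β * Q 0 with hf₀
  have hpos : ∀ s : ℝ, 1 + s ^ 2 ≠ 0 := fun s => by positivity
  have hp : ∀ s : ℝ, HasDerivAt (fun s : ℝ => 1 + s ^ 2) (2 * s) s := fun s => by
    simpa using (hasDerivAt_pow 2 s).const_add 1
  have hsq : ∀ s : ℝ, HasDerivAt (fun s : ℝ => √(1 + s ^ 2)) (s / √(1 + s ^ 2)) s := fun s => by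
    convert! (hp s).sqrt (hpos s) using 1
    field_simp
  have hmin : IsLocalMin
      (fun s => α * W s + β * ((1 + s ^ 2) * Q s) - f₀ * √(1 + s ^ 2)) 0 := by
    filter_upwards [h] with s hs
    simp only [ne_eq, OfNat.ofNat_ne_zero, not_false_eq_true, zero_pow, add_zero, Real.sqrt_one]
    linarith
  have h1 : ∀ᶠ s in 𝓝 (0 : ℝ), HasDerivAt
      (fun s => α * W s + β * ((1 + s ^ 2) * Q s) - f₀ * √(1 + s ^ 2))
      (α * W' s + β * (2 * s * Q s + (1 + s ^ 2) * Q' s) - f₀ * (s / √(1 + s ^ 2))) s := by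
    filter_upwards [hW, hQ] with s hWs hQs
    exact ((hWs.const_mul α).add (((hp s).mul hQs).const_mul β)).sub ((hsq s).const_mul f₀)
  have h2 := (hW'.const_mul α).add
    ((((hasDerivAt_id (0 : ℝ)).const_mul 2).mul hQ.self_of_nhds |>.add
      ((hp 0).mul hQ')).const_mul β) |>.sub
    (((hasDerivAt_id (0 : ℝ)).div (hsq 0) (by simp)).const_mul f₀)
  have := second_deriv_nonneg_of_isLocalMin hmin h1 h2
  simp only [id, ne_eq, OfNat.ofNat_ne_zero, not_false_eq_true, zero_pow, add_zero,
    Real.sqrt_one, mul_one, mul_zero, zero_mul, one_mul, zero_add, div_one, sub_zero, one_pow] at this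
  linarith

/-- The normal is moved along the straight line `n + s v`, of length `√(1 + s²)`, instead of a great
circle. All derivatives are then ordinary directional ones, and the sphere's curvature appears as
the zeroth-order terms. The factor `‖n + s v‖` in the hypothesis clears the denominator in the speed
`-∂ₜw / ‖z‖`. -/
theorem dirDeriv_sq_nonneg_of_norm_le {w : ℝ × E3 → ℝ} {U : Set (ℝ × E3)} (hU : IsOpen U)
    (hw : ContDiffOn ℝ 4 w U) {t₀ : ℝ} {n v ζ : E3} (hn : ‖n‖ = 1) (hv : ‖v‖ = 1)
    (hvn : inner ℝ n v = 0) (h₀ : (t₀, n) ∈ U) {α β f₀ : ℝ}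
    (hf₀ : f₀ = α * dirDeriv (1, 0) w (t₀, n) + β * dirDeriv (0, ζ) (dirDeriv (0, ζ) w) (t₀, n))
    (h : ∀ s : ℝ, (t₀, n + s • v) ∈ U → f₀ * ‖n + s • v‖ ≤
      α * dirDeriv (1, 0) w (t₀, n + s • v) +
        β * (‖n + s • v‖ ^ 2 * dirDeriv (0, ζ) (dirDeriv (0, ζ) w) (t₀, n + s • v))) :
    0 ≤ α * (dirDeriv (0, v) (dirDeriv (0, v) (dirDeriv (1, 0) w)) (t₀, n)
          - dirDeriv (1, 0) w (t₀, n)) +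
        β * (dirDeriv (0, ζ) (dirDeriv (0, ζ) w) (t₀, n) +
          dirDeriv (0, v) (dirDeriv (0, v) (dirDeriv (0, ζ) (dirDeriv (0, ζ) w))) (t₀, n)) := by
  have hline : ∀ s : ℝ, ((t₀, n) : ℝ × E3) + s • ((0 : ℝ), v) = (t₀, n + s • v) := fun s => by simp
  have hnorm : ∀ s : ℝ, ‖n + s • v‖ ^ 2 = 1 + s ^ 2 := fun s => by
    rw [norm_add_sq_real, inner_smul_right, hvn, norm_smul, hn, hv]
    simp
  have hnorm' : ∀ s : ℝ, ‖n + s • v‖ = √(1 + s ^ 2) := fun s => by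
    rw [← hnorm, Real.sqrt_sq (norm_nonneg _)]
  have hev : ∀ᶠ s : ℝ in 𝓝 0, ((t₀, n) : ℝ × E3) + s • ((0 : ℝ), v) ∈ U := by
    have hc : Continuous fun s : ℝ => ((t₀, n) : ℝ × E3) + s • ((0 : ℝ), v) := by fun_prop
    exact hc.continuousAt.eventually (hU.mem_nhds (by simpa using h₀))
  have key : ∀ F : ℝ × E3 → ℝ, ContDiffOn ℝ 2 F U →
      (∀ᶠ s : ℝ in 𝓝 0, HasDerivAt (fun s : ℝ => F (((t₀, n) : ℝ × E3) + s • ((0 : ℝ), v)))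
        (dirDeriv (0, v) F (((t₀, n) : ℝ × E3) + s • ((0 : ℝ), v))) s) ∧
      HasDerivAt (fun s : ℝ => dirDeriv (0, v) F (((t₀, n) : ℝ × E3) + s • ((0 : ℝ), v)))
        (dirDeriv (0, v) (dirDeriv (0, v) F) (t₀, n)) 0 := fun F hF => by
    refine ⟨hev.mono fun s hs => hasDerivAt_line
      ((hF.differentiableOn two_ne_zero).differentiableAt (hU.mem_nhds hs)), ?_⟩
    have h0 : (t₀, n) + (0 : ℝ) • ((0 : ℝ), v) ∈ U := by simpa using h₀
    simpa using hasDerivAt_line (((contDiffOn_dirDeriv hU hF (m := 1) (by norm_num) (0, v)).differentiableOn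
      one_ne_zero).differentiableAt (hU.mem_nhds h0))
  have hW := key (dirDeriv (1, 0) w) (contDiffOn_dirDeriv hU hw (by norm_num) _)
  have hQ := key (dirDeriv (0, ζ) (dirDeriv (0, ζ) w))
    (contDiffOn_dirDeriv hU (contDiffOn_dirDeriv hU hw (m := 3) (by norm_num) _) (by norm_num) _)
  have := second_deriv_nonneg_of_sqrt_le (α := α) (β := β) hW.1 hW.2 hQ.1 hQ.2 (by
    filter_upwards [hev] with s hs
    rw [hline] at hs ⊢
    have := h s hs
    rw [hnorm, hnorm', hf₀] at this
    simpa using this)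
  simpa using this

/-- The pointwise form of the maximum principle. Here `w` plays the role of the support function,
`R₁ ≥ R₂` of the radii of curvature and `κ` of the normal speed, all in terms of time and a
direction, and `(a₁, a₂)`, `(k₁, k₂)` are the gradients of the monitored function and of the speed
in `(R₁, R₂)`. Only the convexity inequalities at the contact point enter, so that no regularity
of `R₁` and `R₂` is needed where they coincide. -/
theorem not_first_contact {w R₁ R₂ κ : ℝ × E3 → ℝ} {U : Set (ℝ × E3)} (hU : IsOpen U)
    (hw : ContDiffOn ℝ 4 w U) {t₀ : ℝ} {e₁ e₂ n : E3} (he₁ : ‖e₁‖ = 1) (he₂ : ‖e₂‖ = 1)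
    (hn : ‖n‖ = 1) (h₁₂ : inner ℝ e₁ e₂ = 0) (hn₁ : inner ℝ n e₁ = 0) (hn₂ : inner ℝ n e₂ = 0)
    (h₀ : (t₀, n) ∈ U)
    (hκ : ∀ z ∈ U, dirDeriv (1, 0) w z = -(‖z.2‖ * κ z))
    (hR : ∀ z ∈ U, ∀ ζ : E3, ‖ζ‖ = 1 → inner ℝ z.2 ζ = 0 →
      R₂ z ≤ ‖z.2‖ * dirDeriv (0, ζ) (dirDeriv (0, ζ) w) z ∧
      ‖z.2‖ * dirDeriv (0, ζ) (dirDeriv (0, ζ) w) z ≤ R₁ z)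
    (htr : ∀ t, (t, n) ∈ U → R₁ (t, n) + R₂ (t, n) =
      dirDeriv (0, e₁) (dirDeriv (0, e₁) w) (t, n) + dirDeriv (0, e₂) (dirDeriv (0, e₂) w) (t, n))
    (hbase : R₁ (t₀, n) = dirDeriv (0, e₁) (dirDeriv (0, e₁) w) (t₀, n))
    {a₁ a₂ k₁ k₂ ε : ℝ} (ha₁ : 0 ≤ a₁) (ha₂ : 0 ≤ a₂) (hk₁ : k₁ < 0) (hk₂ : k₂ < 0)
    (hb : 0 ≤ a₂ * k₁ - a₁ * k₂) (hε : 0 < ε) (hκ₀ : 0 ≤ κ (t₀, n))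
    (hK : ∀ z ∈ U, k₁ * (R₁ z - R₁ (t₀, n)) + k₂ * (R₂ z - R₂ (t₀, n)) ≤ κ z - κ (t₀, n))
    (hH : ∀ z ∈ U, z.1 ≤ t₀ →
      a₁ * (R₁ z - R₁ (t₀, n)) + a₂ * (R₂ z - R₂ (t₀, n)) ≤ ε * (z.1 - t₀)) : False := by
  set A := dirDeriv (0, e₁) (dirDeriv (0, e₁) w) with hA
  set C := dirDeriv (0, e₂) (dirDeriv (0, e₂) w) with hC
  set b := a₂ * k₁ - a₁ * k₂ with hb_def
  have hR20 : R₂ (t₀, n) = C (t₀, n) := by linarith [htr t₀ h₀]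
  have hCA : C (t₀, n) ≤ A (t₀, n) := by
    have := (hR _ h₀ e₁ he₁ hn₁).1
    simp only [hn, one_mul] at this
    linarith
  have hW0 : dirDeriv (1, 0) w (t₀, n) = -κ (t₀, n) := by simpa [hn] using hκ _ h₀
  have hnpos : ∀ {v : E3} (s : ℝ), ‖v‖ = 1 → inner ℝ n v = 0 → 0 < ‖n + s • v‖ := fun s hv hnv => by
    rw [norm_pos_iff]
    intro h
    have := congrArg (inner ℝ n) h
    simp [inner_add_right, inner_smul_right, hnv, hn] at this
  have hin : ∀ {v ζ : E3} (s : ℝ), inner ℝ n ζ = 0 → inner ℝ v ζ = 0 →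
      inner ℝ (n + s • v) ζ = 0 := fun s h h' => by
    simp [inner_add_left, inner_smul_left, h, h']
  -- comparison along the first axis
  have hax₁ := dirDeriv_sq_nonneg_of_norm_le hU hw (ζ := e₂) hn he₁ hn₁ h₀ (α := -a₁) (β := b) rfl
    (fun s hs => by
      have hpos := hnpos s he₁ hn₁
      set N := ‖n + s • e₁‖
      have h1 := (hR _ hs e₂ he₂ (hin s hn₂ h₁₂)).1
      have h2 := hκ _ hs
      have h3 := hK _ hs
      have h4 := hH _ hs le_rfl
      simp only [sub_self, mul_zero, hR20] at h1 h2 h3 h4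
      change R₂ (t₀, n + s • e₁) ≤ N * C (t₀, n + s • e₁) at h1
      rw [h2, hW0]
      change (-a₁ * -κ (t₀, n) + b * C (t₀, n)) * N ≤ -a₁ * -(N * κ (t₀, n + s • e₁)) +
        b * (N ^ 2 * C (t₀, n + s • e₁))
      -- Adding `a₁` times the inequality for `κ` and `-k₁` times the one for the monitored function
      -- cancels `R₁` and leaves `b` in front of `R₂`.
      have h5 : -a₁ * -κ (t₀, n) + b * C (t₀, n) ≤
          a₁ * κ (t₀, n + s • e₁) + b * (N * C (t₀, n + s • e₁)) := by
        have := mul_le_mul_of_nonneg_left h1 hb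
        have := mul_le_mul_of_nonneg_left h3 ha₁
        have := mul_le_mul_of_nonneg_left h4 (neg_nonneg.2 hk₁.le)
        simp only [hb_def] at *
        linarith
      have := mul_le_mul_of_nonneg_right h5 hpos.le
      linarith)
  -- comparison along the second axis
  have hax₂ := dirDeriv_sq_nonneg_of_norm_le hU hw (ζ := e₁) hn he₂ hn₂ h₀ (α := -a₂) (β := -b) rfl
    (fun s hs => by
      have hpos := hnpos s he₂ hn₂
      set N := ‖n + s • e₂‖
      have h1 := (hR _ hs e₁ he₁ (hin s hn₁ (by rw [real_inner_comm]; exact h₁₂))).2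
      have h2 := hκ _ hs
      have h3 := hK _ hs
      have h4 := hH _ hs le_rfl
      simp only [sub_self, mul_zero, hbase] at h1 h2 h3 h4
      change N * A (t₀, n + s • e₂) ≤ R₁ (t₀, n + s • e₂) at h1
      rw [h2, hW0]
      change (-a₂ * -κ (t₀, n) + -b * A (t₀, n)) * N ≤ -a₂ * -(N * κ (t₀, n + s • e₂)) +
        -b * (N ^ 2 * A (t₀, n + s • e₂))
      -- Here the weights `a₂` and `-k₂` cancel `R₂`. The coefficient of `R₁` is `-b ≤ 0`, so the
      -- lower Rayleigh bound for `R₁` is the one needed.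
      have h5 : -a₂ * -κ (t₀, n) + -b * A (t₀, n) ≤
          a₂ * κ (t₀, n + s • e₂) + -b * (N * A (t₀, n + s • e₂)) := by
        have := mul_le_mul_of_nonneg_left h1 hb
        have := mul_le_mul_of_nonneg_left h3 ha₂
        have := mul_le_mul_of_nonneg_left h4 (neg_nonneg.2 hk₂.le)
        simp only [hb_def] at *
        linarith
      have := mul_le_mul_of_nonneg_right h5 hpos.le
      linarith)
  -- exchange of derivatives
  have hw2 : ContDiffOn ℝ 2 w U := hw.of_le (by norm_num)
  have hD : ∀ v, ContDiffOn ℝ 2 (dirDeriv v w) U := fun v => contDiffOn_dirDeriv hU hw (by norm_num) v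
  have hDD : ∀ v v', ContDiffOn ℝ 2 (dirDeriv v (dirDeriv v' w)) U := fun v v' =>
    contDiffOn_dirDeriv hU (contDiffOn_dirDeriv hU hw (m := 3) (by norm_num) v') (by norm_num) v
  have hswap : ∀ x y : ℝ × E3, EqOn (dirDeriv x (dirDeriv x (dirDeriv y w)))
      (dirDeriv y (dirDeriv x (dirDeriv x w))) U := fun x y =>
    (dirDeriv_congr hU (dirDeriv_comm hU hw2 x y) x).trans (dirDeriv_comm hU (hD x) x y)
  have hswap₂ : ∀ x y : ℝ × E3, EqOn (dirDeriv x (dirDeriv x (dirDeriv y (dirDeriv y w))))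
      (dirDeriv y (dirDeriv y (dirDeriv x (dirDeriv x w)))) U := fun x y =>
    (dirDeriv_congr hU (dirDeriv_comm hU (hD y) x y) x).trans
      ((dirDeriv_comm hU (hDD x y) x y).trans (dirDeriv_congr hU (hswap x y) y))
  -- After the exchange both inequalities contain the same fourth derivative of `w`, with
  -- coefficients `b` and `-b`, so it drops out of their sum.
  rw [hswap (0, e₁) (1, 0) h₀, hswap₂ (0, e₁) (0, e₂) h₀, hW0] at hax₁
  rw [hswap (0, e₂) (1, 0) h₀, hW0] at hax₂
  -- comparison in time
  have hline : ∀ s : ℝ, ((0 : ℝ), n) + s • ((1 : ℝ), (0 : E3)) = (s, n) := fun s => by simp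
  have htime : ∀ F : ℝ × E3 → ℝ, ContDiffOn ℝ 2 F U →
      HasDerivAt (fun t : ℝ => F (t, n)) (dirDeriv (1, 0) F (t₀, n)) t₀ := fun F hF => by
    have := hasDerivAt_line (F := F) (x := ((0 : ℝ), n)) (v := ((1 : ℝ), (0 : E3))) (s := t₀)
      (by rw [hline]; exact (hF.differentiableOn two_ne_zero).differentiableAt (hU.mem_nhds h₀))
    simpa only [hline] using this
  have hev : ∀ᶠ t : ℝ in 𝓝 t₀, (t, n) ∈ U := by
    have hc : Continuous fun t : ℝ => ((t, n) : ℝ × E3) := by fun_prop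
    exact hc.continuousAt.eventually (hU.mem_nhds h₀)
  have hAt := htime A (hDD _ _)
  have hCt := htime C (hDD _ _)
  have hkey : ε ≤ a₁ * dirDeriv (1, 0) A (t₀, n) + a₂ * dirDeriv (1, 0) C (t₀, n) := by
    -- The trace `R₁ + R₂ = A + C` is smooth in time, so only `(a₁ - a₂) R₁` has to be compared with
    -- `(a₁ - a₂) A`. For `a₂ ≤ a₁` the bound `A ≤ R₁` has the right direction.
    rcases le_total a₂ a₁ with hq | hq
    · refine le_deriv_of_le_left ((hAt.const_mul a₁).add (hCt.const_mul a₂)) ?_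
      filter_upwards [hev] with t ht htle
      have h1 := (hR _ ht e₁ he₁ hn₁).2
      have h2 := hH _ ht htle
      have h3 := htr t ht
      simp only [hn, one_mul] at h1
      change A (t, n) ≤ _ at h1
      simp only [Pi.add_apply]
      have := mul_le_mul_of_nonneg_left h1 (sub_nonneg.2 hq)
      rw [hbase, hR20] at h2
      have h4 : R₂ (t, n) = A (t, n) + C (t, n) - R₁ (t, n) := by linarith
      rw [h4] at h2
      simp only at h2
      linarith
    · rcases hq.eq_or_lt with hq | hq
      · refine le_deriv_of_le_left ((hAt.const_mul a₁).add (hCt.const_mul a₂)) ?_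
        filter_upwards [hev] with t ht htle
        have h2 := hH _ ht htle
        have h3 := htr t ht
        simp only [Pi.add_apply]
        rw [hbase, hR20] at h2
        have h4 : R₂ (t, n) = A (t, n) + C (t, n) - R₁ (t, n) := by linarith
        rw [h4] at h2
        simp only at h2
        rw [← hq] at h2 ⊢
        linarith
      -- When `a₁ < a₂` the bound `A ≤ R₁` points the wrong way. The bracket condition now forces
      -- `k₁ > k₂`, so the smooth speed `κ = -∂ₜw` can bound `R₁` from above instead.
      have hl : 0 < k₁ - k₂ := by
        by_contra! hl
        nlinarith
      have hκt : HasDerivAt (fun t : ℝ => -dirDeriv (1, 0) w (t, n))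
          (-dirDeriv (1, 0) (dirDeriv (1, 0) w) (t₀, n)) t₀ := (htime _ (hD _)).neg
      set κ' := -dirDeriv (1, 0) (dirDeriv (1, 0) w) (t₀, n)
      have hκe : ∀ t, (t, n) ∈ U → -dirDeriv (1, 0) w (t, n) = κ (t, n) := fun t ht => by
        simp [hκ _ ht, hn]
      have hTt := hAt.add hCt
      -- The tangent-plane inequality for `κ` holds on both sides of `t₀`, so this is a two-sided
      -- minimum. Its critical-point equation determines `κ'` in terms of `A'` and `C'`.
      have hmin : IsLocalMin (fun t : ℝ => -dirDeriv (1, 0) w (t, n) -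
          (k₂ * (A (t, n) + C (t, n)) + (k₁ - k₂) * A (t, n))) t₀ := by
        filter_upwards [hev] with t ht
        have h1 := (hR _ ht e₁ he₁ hn₁).2
        simp only [hn, one_mul] at h1
        change A (t, n) ≤ _ at h1
        have h2 := hK _ ht
        have h3 := htr t ht
        rw [hκe t ht, hκe t₀ h₀]
        rw [hbase, hR20] at h2
        have h4 : R₂ (t, n) = A (t, n) + C (t, n) - R₁ (t, n) := by linarith
        rw [h4] at h2
        have := mul_le_mul_of_nonneg_left h1 hl.le
        linarith
      have hκ' := hmin.hasDerivAt_eq_zero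
        (hκt.sub ((hTt.const_mul k₂).add (hAt.const_mul (k₁ - k₂))))
      set A' := dirDeriv (1, 0) A (t₀, n)
      set C' := dirDeriv (1, 0) C (t₀, n)
      have hfin : ε * (k₁ - k₂) ≤ (k₁ - k₂) * (a₂ * (A' + C')) +
          (a₁ - a₂) * (κ' - k₂ * (A' + C')) := by
        refine le_deriv_of_le_left (((hTt.const_mul a₂).const_mul (k₁ - k₂)).add
          ((hκt.sub (hTt.const_mul k₂)).const_mul (a₁ - a₂))) ?_
        filter_upwards [hev] with t ht htle
        simp only [Pi.add_apply, Pi.sub_apply]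
        rw [hκe t ht, hκe t₀ h₀]
        have h2 := hK _ ht
        have h3 := htr t ht
        have h5 := hH _ ht htle
        rw [hbase, hR20] at h2 h5
        have h4 : R₂ (t, n) = A (t, n) + C (t, n) - R₁ (t, n) := by linarith
        rw [h4] at h2 h5
        simp only at h5
        have := mul_le_mul_of_nonneg_left h5 hl.le
        have := mul_le_mul_of_nonneg_left h2 (sub_nonneg.2 hq.le)
        linarith
      have : ε * (k₁ - k₂) ≤ (a₁ * A' + a₂ * C') * (k₁ - k₂) := by
        have h6 : κ' - k₂ * (A' + C') = (k₁ - k₂) * A' := by linarith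
        rw [h6] at hfin
        linarith
      exact le_of_mul_le_mul_right this hl
  -- The two spatial tests add up to `a₁∂ₜA + a₂∂ₜC ≤ -(a₁ + a₂)κ - b(A - C)`, whose right side is
  -- nonpositive, against the lower bound `ε`.
  have h7 := mul_nonneg hb (sub_nonneg.2 hCA)
  have h8 := mul_nonneg ha₁ hκ₀
  have h9 := mul_nonneg ha₂ hκ₀
  linarith

/-! ### Linear algebra of the two fundamental forms -/

section Radii

variable {W : Type*} [AddCommGroup W] [Module ℝ W]

/-- Principal directions and radii: the pair of linear maps `P`, `Q` (the differentials of the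
position and of the normal) is simultaneously diagonalized by `b₁`, `b₂`, whose images under `Q` are
orthonormal. -/
structure IsPrincipal (P Q : W →ₗ[ℝ] E3) (ρ₁ ρ₂ : ℝ) (b₁ b₂ : W) : Prop where
  norm₁ : ‖Q b₁‖ = 1
  norm₂ : ‖Q b₂‖ = 1
  orth : inner ℝ (Q b₁) (Q b₂) = 0
  eigen₁ : P b₁ = ρ₁ • Q b₁
  eigen₂ : P b₂ = ρ₂ • Q b₂
  le : ρ₂ ≤ ρ₁
  expand : ∀ v, v = (inner ℝ (Q v) (Q b₁) : ℝ) • b₁ + (inner ℝ (Q v) (Q b₂) : ℝ) • b₂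

/-- By dimension, `Q` identifies `W` with the plane orthogonal to `n`. There `P ∘ Q⁻¹` is
self-adjoint by the symmetry hypothesis, so the spectral theorem gives an orthonormal eigenbasis,
pulled back by `Q`. -/
theorem exists_isPrincipal (hW : Module.finrank ℝ W = 2) {P Q : W →ₗ[ℝ] E3} {n : E3}
    (hn : ‖n‖ = 1) (hP : ∀ v, inner ℝ (P v) n = 0) (hQ : ∀ v, inner ℝ (Q v) n = 0)
    (hsymm : ∀ v w, inner ℝ (P v) (Q w) = inner ℝ (P w) (Q v))
    (hinj : Function.Injective Q) : ∃ ρ₁ ρ₂ b₁ b₂, IsPrincipal P Q ρ₁ ρ₂ b₁ b₂ := by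
  have hn0 : n ≠ 0 := by rintro rfl; simp at hn
  have : Fact (Module.finrank ℝ E3 = 2 + 1) := ⟨by simp⟩
  have : FiniteDimensional ℝ W := Module.finite_of_finrank_pos (by omega)
  set V := (ℝ ∙ n)ᗮ with hV
  have hVr : Module.finrank ℝ V = 2 := Submodule.finrank_orthogonal_span_singleton hn0
  have hmem : ∀ x : E3, inner ℝ x n = 0 → x ∈ V := fun x hx =>
    Submodule.mem_orthogonal_singleton_iff_inner_left.2 hx
  let P' : W →ₗ[ℝ] V := P.codRestrict V fun v => hmem _ (hP v)
  let Q' : W →ₗ[ℝ] V := Q.codRestrict V fun v => hmem _ (hQ v)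
  have hQ'inj : Function.Injective Q' := fun v w h => hinj (congrArg Subtype.val h)
  let e : W ≃ₗ[ℝ] V := LinearEquiv.ofInjectiveOfFinrankEq Q' hQ'inj (hW.trans hVr.symm)
  have he : ∀ v, ((e v : V) : E3) = Q v := fun v => rfl
  have he' : ∀ x : V, Q (e.symm x) = x := fun x => by rw [← he, e.apply_symm_apply]
  let T : V →ₗ[ℝ] V := P' ∘ₗ e.symm.toLinearMap
  have hTx : ∀ x : V, ((T x : V) : E3) = P (e.symm x) := fun x => rfl
  have hT : T.IsSymmetric := fun x y => by
    change inner ℝ ((T x : V) : E3) (y : E3) = inner ℝ (x : E3) ((T y : V) : E3)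
    rw [hTx, hTx, ← he' y, hsymm, he', real_inner_comm]
  let B := hT.eigenvectorBasis hVr
  have hB : ∀ i, P (e.symm (B i)) = hT.eigenvalues hVr i • Q (e.symm (B i)) := fun i => by
    rw [← hTx, hT.apply_eigenvectorBasis hVr i, he']
    simp [B]
  have hon : ∀ i j, inner ℝ (Q (e.symm (B i))) (Q (e.symm (B j))) = if i = j then (1 : ℝ) else 0 :=
    fun i j => by
      rw [he', he']
      exact orthonormal_iff_ite.1 B.orthonormal i j
  have hnorm : ∀ i, ‖Q (e.symm (B i))‖ = 1 := fun i => by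
    rw [he']
    exact B.orthonormal.1 i
  refine ⟨_, _, e.symm (B 0), e.symm (B 1), hnorm 0, hnorm 1, by simpa using hon 0 1, hB 0, hB 1,
    hT.eigenvalues_antitone hVr (by simp), fun v => ?_⟩
  apply e.injective
  have := B.sum_repr (e v)
  rw [Fin.sum_univ_two, B.repr_apply_apply, B.repr_apply_apply] at this
  rw [map_add, map_smul, map_smul, e.apply_symm_apply, e.apply_symm_apply, he', he', ← he,
    real_inner_comm, real_inner_comm (B 1 : E3)]
  exact this.symm

namespace IsPrincipal

variable {P Q : W →ₗ[ℝ] E3} {ρ₁ ρ₂ : ℝ} {b₁ b₂ : W}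

theorem map_right (h : IsPrincipal P Q ρ₁ ρ₂ b₁ b₂) (v : W) :
    Q v = (inner ℝ (Q v) (Q b₁) : ℝ) • Q b₁ + (inner ℝ (Q v) (Q b₂) : ℝ) • Q b₂ := by
  conv_lhs => rw [h.expand v]
  simp

theorem map_left (h : IsPrincipal P Q ρ₁ ρ₂ b₁ b₂) (v : W) :
    P v = (inner ℝ (Q v) (Q b₁) * ρ₁ : ℝ) • Q b₁ + (inner ℝ (Q v) (Q b₂) * ρ₂ : ℝ) • Q b₂ := by
  conv_lhs => rw [h.expand v]
  simp [h.eigen₁, h.eigen₂, smul_smul]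

theorem setOf_eq (h : IsPrincipal P Q ρ₁ ρ₂ b₁ b₂) :
    {r : ℝ | ∃ v, v ≠ 0 ∧ P v = r • Q v} = {ρ₁, ρ₂} := by
  have hb : ∀ b, ‖Q b‖ = 1 → b ≠ 0 := by
    rintro b hb rfl
    simp at hb
  ext r
  constructor
  · rintro ⟨v, hv, hr⟩
    have hQv := h.map_right v
    rw [h.map_left v] at hr
    set x := (inner ℝ (Q v) (Q b₁) : ℝ) with hx
    set y := (inner ℝ (Q v) (Q b₂) : ℝ) with hy
    rw [hQv] at hr
    have h1 := congrArg (fun z => inner ℝ (Q b₁) z) hr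
    have h2 := congrArg (fun z => inner ℝ (Q b₂) z) hr
    have ho := h.orth
    have ho' := h.orth
    rw [real_inner_comm] at ho'
    simp only [inner_add_right, inner_smul_right, ho, ho', real_inner_self_eq_norm_sq, h.norm₁,
      h.norm₂] at h1 h2
    by_contra hne
    simp only [mem_insert_iff, mem_singleton_iff, not_or] at hne
    have hx0 : x = 0 := by
      have : x * (r - ρ₁) = 0 := by linarith
      exact (mul_eq_zero.1 this).resolve_right (sub_ne_zero.2 hne.1)
    have hy0 : y = 0 := by
      have : y * (r - ρ₂) = 0 := by linarith
      exact (mul_eq_zero.1 this).resolve_right (sub_ne_zero.2 hne.2)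
    apply hv
    rw [h.expand v, ← hx, ← hy, hx0, hy0]
    simp
  · rintro (rfl | rfl)
    · exact ⟨b₁, hb _ h.norm₁, h.eigen₁⟩
    · exact ⟨b₂, hb _ h.norm₂, h.eigen₂⟩

theorem sSup_eq (h : IsPrincipal P Q ρ₁ ρ₂ b₁ b₂) :
    sSup {r : ℝ | ∃ v, v ≠ 0 ∧ P v = r • Q v} = ρ₁ := by
  rw [h.setOf_eq, csSup_pair, sup_eq_left.2 h.le]

theorem sInf_eq (h : IsPrincipal P Q ρ₁ ρ₂ b₁ b₂) :
    sInf {r : ℝ | ∃ v, v ≠ 0 ∧ P v = r • Q v} = ρ₂ := by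
  rw [h.setOf_eq, csInf_pair, inf_eq_right.2 h.le]

theorem inner_right (h : IsPrincipal P Q ρ₁ ρ₂ b₁ b₂) (v w : W) :
    inner ℝ (Q v) (Q w) = inner ℝ (Q v) (Q b₁) * inner ℝ (Q w) (Q b₁) +
      inner ℝ (Q v) (Q b₂) * (inner ℝ (Q w) (Q b₂) : ℝ) := by
  conv_lhs => rw [h.map_right w]
  simp only [inner_add_right, inner_smul_right]
  ring

theorem inner_left (h : IsPrincipal P Q ρ₁ ρ₂ b₁ b₂) (v w : W) :
    inner ℝ (P v) (Q w) = ρ₁ * (inner ℝ (Q v) (Q b₁) * inner ℝ (Q w) (Q b₁)) +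
      ρ₂ * (inner ℝ (Q v) (Q b₂) * (inner ℝ (Q w) (Q b₂) : ℝ)) := by
  rw [h.map_left v, real_inner_comm]
  simp only [inner_add_right, inner_smul_right]
  ring

/-- Rayleigh quotients lie between the radii of curvature. -/
theorem rayleigh (h : IsPrincipal P Q ρ₁ ρ₂ b₁ b₂) {v : W} (hv : ‖Q v‖ = 1) :
    ρ₂ ≤ inner ℝ (P v) (Q v) ∧ inner ℝ (P v) (Q v) ≤ ρ₁ := by
  have h1 := h.inner_right v v
  rw [real_inner_self_eq_norm_sq, hv] at h1
  rw [h.inner_left v v]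
  have hle := h.le
  set x := (inner ℝ (Q v) (Q b₁) : ℝ)
  set y := (inner ℝ (Q v) (Q b₂) : ℝ)
  have hxy : y * y = 1 - x * x := by linarith
  have hxy' : x * x = 1 - y * y := by linarith
  constructor
  · rw [hxy]
    nlinarith [mul_self_nonneg x]
  · rw [hxy']
    nlinarith [mul_self_nonneg y]

/-- Together with `det_mul_gram`, this expresses the symmetric functions of the radii through an
arbitrary frame. Unlike principal directions, such a frame can be kept fixed while the point varies.
-/
theorem trace_mul_gram (h : IsPrincipal P Q ρ₁ ρ₂ b₁ b₂) (v w : W) :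
    (ρ₁ + ρ₂) * (inner ℝ (Q v) (Q v) * inner ℝ (Q w) (Q w) - inner ℝ (Q v) (Q w) ^ 2) =
      inner ℝ (P v) (Q v) * inner ℝ (Q w) (Q w) + inner ℝ (P w) (Q w) * inner ℝ (Q v) (Q v) -
        2 * (inner ℝ (P v) (Q w) * (inner ℝ (Q v) (Q w) : ℝ)) := by
  rw [h.inner_right v v, h.inner_right w w, h.inner_right v w, h.inner_left v v, h.inner_left w w,
    h.inner_left v w]
  ring

theorem det_mul_gram (h : IsPrincipal P Q ρ₁ ρ₂ b₁ b₂) (v w : W) :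
    (ρ₁ * ρ₂) * (inner ℝ (Q v) (Q v) * inner ℝ (Q w) (Q w) - inner ℝ (Q v) (Q w) ^ 2) =
      inner ℝ (P v) (Q v) * inner ℝ (P w) (Q w) - (inner ℝ (P v) (Q w) : ℝ) ^ 2 := by
  rw [h.inner_right v v, h.inner_right w w, h.inner_right v w, h.inner_left v v, h.inner_left w w,
    h.inner_left v w]
  ring

/-- The trace of the second fundamental form in a frame that is orthonormal for the third. -/
theorem trace_eq (h : IsPrincipal P Q ρ₁ ρ₂ b₁ b₂) {v w : W} (hv : ‖Q v‖ = 1) (hw : ‖Q w‖ = 1)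
    (hvw : inner ℝ (Q v) (Q w) = 0) :
    ρ₁ + ρ₂ = inner ℝ (P v) (Q v) + inner ℝ (P w) (Q w) := by
  have := h.trace_mul_gram v w
  rw [hvw, real_inner_self_eq_norm_sq, real_inner_self_eq_norm_sq, hv, hw] at this
  linarith

theorem gram_ne_zero (h : IsPrincipal P Q ρ₁ ρ₂ b₁ b₂) {v w : W}
    (hvw : LinearIndependent ℝ ![v, w]) :
    inner ℝ (Q v) (Q v) * inner ℝ (Q w) (Q w) - (inner ℝ (Q v) (Q w) : ℝ) ^ 2 ≠ 0 := by
  rw [LinearIndependent.pair_iff] at hvw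
  rw [h.inner_right v v, h.inner_right w w, h.inner_right v w]
  have hv := h.expand v
  have hw := h.expand w
  set x := (inner ℝ (Q v) (Q b₁) : ℝ)
  set y := (inner ℝ (Q v) (Q b₂) : ℝ)
  set x' := (inner ℝ (Q w) (Q b₁) : ℝ)
  set y' := (inner ℝ (Q w) (Q b₂) : ℝ)
  intro h0
  -- The Gram determinant is the square of the coordinate determinant in the basis `b₁, b₂`.
  have hd : x * y' - y * x' = 0 := by
    have : (x * y' - y * x') ^ 2 = 0 := by linarith
    exact pow_eq_zero_iff two_ne_zero |>.1 this
  have h1 := hvw y' (-y) (by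
    rw [hv, hw, smul_add, smul_add, smul_smul, smul_smul, smul_smul, smul_smul]
    have : (y' * x) • b₁ + (y' * y) • b₂ + ((-y * x') • b₁ + (-y * y') • b₂) =
        (x * y' - y * x') • b₁ := by module
    rw [this, hd, zero_smul])
  have h2 := hvw x' (-x) (by
    rw [hv, hw, smul_add, smul_add, smul_smul, smul_smul, smul_smul, smul_smul]
    have : (x' * x) • b₁ + (x' * y) • b₂ + ((-x * x') • b₁ + (-x * y') • b₂) =
        (-(x * y' - y * x')) • b₂ := by module
    rw [this, hd, neg_zero, zero_smul])
  have hv0 : v = 0 := by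
    rw [hv, neg_eq_zero.1 h1.2, neg_eq_zero.1 h2.2]
    simp
  have := hvw 1 0 (by simp [hv0])
  simp at this

end IsPrincipal

end Radii

/-! ### The unit normal as a cross product -/

/-- The cross product on Euclidean 3-space. -/
def cross (a b : E3) : E3 :=
  !₂[a 1 * b 2 - a 2 * b 1, a 2 * b 0 - a 0 * b 2, a 0 * b 1 - a 1 * b 0]

theorem inner_E3 (a b : E3) : inner ℝ a b = a 0 * b 0 + a 1 * b 1 + a 2 * b 2 := by
  simp [PiLp.inner_apply, Fin.sum_univ_three]
  ring

theorem contDiff_cross : ContDiff ℝ ∞ fun q : E3 × E3 => cross q.1 q.2 := by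
  rw [contDiff_euclidean]
  have h1 : ∀ j : Fin 3, ContDiff ℝ ∞ fun q : E3 × E3 => q.1 j := fun j =>
    (contDiff_euclidean.1 contDiff_fst) j
  have h2 : ∀ j : Fin 3, ContDiff ℝ ∞ fun q : E3 × E3 => q.2 j := fun j =>
    (contDiff_euclidean.1 contDiff_snd) j
  intro i
  fin_cases i
  · exact ((h1 1).mul (h2 2)).sub ((h1 2).mul (h2 1))
  · exact ((h1 2).mul (h2 0)).sub ((h1 0).mul (h2 2))
  · exact ((h1 0).mul (h2 1)).sub ((h1 1).mul (h2 0))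

theorem cross_ne_zero {a b : E3} (h : LinearIndependent ℝ ![a, b]) : cross a b ≠ 0 := by
  intro h0
  rw [LinearIndependent.pair_iff] at h
  have c0 : a 1 * b 2 - a 2 * b 1 = 0 := congrArg (fun z : E3 => z 0) h0
  have c1 : a 2 * b 0 - a 0 * b 2 = 0 := congrArg (fun z : E3 => z 1) h0
  have c2 : a 0 * b 1 - a 1 * b 0 = 0 := congrArg (fun z : E3 => z 2) h0
  have := (h (inner ℝ a b) (-inner ℝ a a) (by
    rw [inner_E3, inner_E3]
    ext i
    fin_cases i <;> simp
    · linear_combination a 1 * c2 - a 2 * c1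
    · linear_combination -a 0 * c2 + a 2 * c0
    · linear_combination a 0 * c1 - a 1 * c0)).2
  have ha : a = 0 := by simpa using this
  have := h 1 0 (by simp [ha])
  simp at this

theorem eq_smul_cross {a b n : E3} (ha : inner ℝ a n = 0) (hb : inner ℝ b n = 0)
    (hc : cross a b ≠ 0) :
    n = (inner ℝ n (cross a b) / ‖cross a b‖ ^ 2 : ℝ) • cross a b := by
  have hc' : ‖cross a b‖ ^ 2 ≠ 0 := by simpa using hc
  have key : ‖cross a b‖ ^ 2 • n = (inner ℝ n (cross a b) : ℝ) • cross a b := by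
    rw [← real_inner_self_eq_norm_sq, inner_E3, inner_E3]
    rw [inner_E3] at ha hb
    ext i
    fin_cases i <;> simp [cross]
    · linear_combination ((a 2 * b 0 - a 0 * b 2) * a 2 - (a 0 * b 1 - a 1 * b 0) * a 1) * hb -
        ((a 2 * b 0 - a 0 * b 2) * b 2 - (a 0 * b 1 - a 1 * b 0) * b 1) * ha
    · linear_combination ((a 0 * b 1 - a 1 * b 0) * a 0 - (a 1 * b 2 - a 2 * b 1) * a 2) * hb -
        ((a 0 * b 1 - a 1 * b 0) * b 0 - (a 1 * b 2 - a 2 * b 1) * b 2) * ha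
    · linear_combination ((a 1 * b 2 - a 2 * b 1) * a 1 - (a 2 * b 0 - a 0 * b 2) * a 0) * hb -
        ((a 1 * b 2 - a 2 * b 1) * b 1 - (a 2 * b 0 - a 0 * b 2) * b 0) * ha
  rw [div_eq_inv_mul, mul_smul, ← key, smul_smul, inv_mul_cancel₀ hc', one_smul]

/-- Orthogonality and unit length fix the normal up to sign. The auxiliary vector `e`, known to
point to the inner side, selects the sign by a formula in `a`, `b`, `e` alone. -/
theorem eq_normalized_cross {a b n e : E3} (ha : inner ℝ a n = 0) (hb : inner ℝ b n = 0)
    (hc : cross a b ≠ 0) (hn : ‖n‖ = 1) (he : inner ℝ e n < 0) :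
    inner ℝ e (cross a b) ≠ 0 ∧
      n = (-(inner ℝ e (cross a b) / (|inner ℝ e (cross a b)| * ‖cross a b‖)) : ℝ) • cross a b := by
  obtain ⟨μ, hμ⟩ : ∃ μ : ℝ, n = μ • cross a b := ⟨_, eq_smul_cross ha hb hc⟩
  set c := cross a b
  have hc' : 0 < ‖c‖ := norm_pos_iff.2 hc
  set d := inner ℝ e c with hd
  have hneg : μ * d < 0 := by rwa [hμ, inner_smul_right] at he
  have hd0 : d ≠ 0 := by
    rintro h
    simp [h] at hneg
  refine ⟨hd0, ?_⟩
  have hnorm : |μ| * ‖c‖ = 1 := by rw [← hn, hμ, norm_smul, Real.norm_eq_abs]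
  rw [hμ]
  congr 1
  rcases mul_neg_iff.1 hneg with ⟨h1, h2⟩ | ⟨h1, h2⟩
  · rw [abs_of_neg h2]
    rw [abs_of_pos h1] at hnorm
    field_simp
    linarith
  · rw [abs_of_pos h2]
    rw [abs_of_neg h1] at hnorm
    field_simp
    linarith

/-! ### Parametrized patches of convex surfaces -/

section Patch

variable {V : Type*} [NormedAddCommGroup V] [NormedSpace ℝ V]

/-- A smooth parametrized surface patch with unit normal `n` and positive definite second
fundamental form. -/
structure IsConvexPatch (O : Set V) (x n : V → E3) : Prop where
  smooth : ContDiffOn ℝ ∞ x O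
  differentiable : ∀ y ∈ O, DifferentiableAt ℝ n y
  norm : ∀ y ∈ O, ‖n y‖ = 1
  orth : ∀ y ∈ O, ∀ v, inner ℝ (fderiv ℝ x y v) (n y) = 0
  pos : ∀ y ∈ O, ∀ v, v ≠ 0 → 0 < inner ℝ (fderiv ℝ x y v) (fderiv ℝ n y v)

namespace IsConvexPatch

variable {O : Set V} {x n : V → E3}

theorem orth_normal (h : IsConvexPatch O x n) (hO : IsOpen O) {y : V} (hy : y ∈ O) (v : V) :
    inner ℝ (fderiv ℝ n y v) (n y) = 0 := by
  have h1 : (fun y => (inner ℝ (n y) (n y) : ℝ)) =ᶠ[𝓝 y] fun _ => (1 : ℝ) := by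
    filter_upwards [hO.mem_nhds hy] with z hz
    rw [real_inner_self_eq_norm_sq, h.norm z hz, one_pow]
  have h2 := fderiv_inner_apply ℝ (h.differentiable y hy) (h.differentiable y hy) v
  rw [h1.fderiv_eq] at h2
  rw [real_inner_comm (fderiv ℝ n y v)] at h2
  simp at h2
  linarith

theorem fderiv_injective (h : IsConvexPatch O x n) {y : V} (hy : y ∈ O) :
    Function.Injective (fderiv ℝ x y) := by
  rw [injective_iff_map_eq_zero]
  intro v hv
  by_contra h0
  have := h.pos y hy v h0
  simp [hv] at this

theorem fderiv_normal_injective (h : IsConvexPatch O x n) {y : V} (hy : y ∈ O) :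
    Function.Injective (fderiv ℝ n y) := by
  rw [injective_iff_map_eq_zero]
  intro v hv
  by_contra h0
  have := h.pos y hy v h0
  simp [hv] at this

theorem inner_second_fderiv (h : IsConvexPatch O x n) (hO : IsOpen O) {y : V} (hy : y ∈ O)
    (v w : V) : inner ℝ (fderiv ℝ (fderiv ℝ x) y w v) (n y) =
      -(inner ℝ (fderiv ℝ x y v) (fderiv ℝ n y w) : ℝ) := by
  have h1 : (fun y => (inner ℝ (fderiv ℝ x y v) (n y) : ℝ)) =ᶠ[𝓝 y] fun _ => (0 : ℝ) := by
    filter_upwards [hO.mem_nhds hy] with z hz using h.orth z hz v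
  have hd : DifferentiableAt ℝ (fderiv ℝ x) y :=
    ((h.smooth.fderiv_of_isOpen hO (m := 1) (by norm_cast)).differentiableOn
      one_ne_zero).differentiableAt (hO.mem_nhds hy)
  have h2 := fderiv_inner_apply ℝ (hd.clm_apply (differentiableAt_const v))
    (h.differentiable y hy) w
  rw [h1.fderiv_eq, fderiv_clm_apply hd (differentiableAt_const v)] at h2
  simp at h2
  linarith

/-- Both sides are minus the normal component of the symmetric second derivative of `x`. -/
theorem symm (h : IsConvexPatch O x n) (hO : IsOpen O) {y : V} (hy : y ∈ O) (v w : V) :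
    inner ℝ (fderiv ℝ x y v) (fderiv ℝ n y w) =
      (inner ℝ (fderiv ℝ x y w) (fderiv ℝ n y v) : ℝ) := by
  have h1 := h.inner_second_fderiv hO hy v w
  have h2 := h.inner_second_fderiv hO hy w v
  have h3 : IsSymmSndFDerivAt ℝ x y :=
    (h.smooth.contDiffAt (hO.mem_nhds hy)).isSymmSndFDerivAt (by simp; norm_cast)
  rw [h3 w v] at h1
  linarith

theorem exists_isPrincipal (h : IsConvexPatch O x n) (hO : IsOpen O)
    (hV : Module.finrank ℝ V = 2) {y : V} (hy : y ∈ O) :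
    ∃ ρ₁ ρ₂ b₁ b₂, IsPrincipal (fderiv ℝ x y : V →ₗ[ℝ] E3) (fderiv ℝ n y : V →ₗ[ℝ] E3)
      ρ₁ ρ₂ b₁ b₂ :=
  CurvatureFlow.exists_isPrincipal hV (h.norm y hy) (h.orth y hy) (h.orth_normal hO hy)
    (h.symm hO hy) (h.fderiv_normal_injective hy)

/-- By convexity the acceleration `D²x(u₁, u₁)` has negative normal component and serves as the
inward vector. The normal thus becomes an explicit function of derivatives of `x`. -/
theorem normal_eq (h : IsConvexPatch O x n) (hO : IsOpen O) {u₁ u₂ : V}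
    (hu : LinearIndependent ℝ ![u₁, u₂]) {y : V} (hy : y ∈ O) :
    cross (fderiv ℝ x y u₁) (fderiv ℝ x y u₂) ≠ 0 ∧
    inner ℝ (fderiv ℝ (fderiv ℝ x) y u₁ u₁) (cross (fderiv ℝ x y u₁) (fderiv ℝ x y u₂)) ≠ 0 ∧
      n y = (-(inner ℝ (fderiv ℝ (fderiv ℝ x) y u₁ u₁) (cross (fderiv ℝ x y u₁) (fderiv ℝ x y u₂)) /
        (|inner ℝ (fderiv ℝ (fderiv ℝ x) y u₁ u₁) (cross (fderiv ℝ x y u₁) (fderiv ℝ x y u₂))| *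
          ‖cross (fderiv ℝ x y u₁) (fderiv ℝ x y u₂)‖)) : ℝ) •
        cross (fderiv ℝ x y u₁) (fderiv ℝ x y u₂) := by
  have hc : cross (fderiv ℝ x y u₁) (fderiv ℝ x y u₂) ≠ 0 := by
    apply cross_ne_zero
    have := hu.map' (fderiv ℝ x y : V →ₗ[ℝ] E3) (LinearMap.ker_eq_bot.2 (h.fderiv_injective hy))
    convert! this using 1
    ext i
    fin_cases i <;> rfl
  refine ⟨hc, eq_normalized_cross (h.orth y hy _) (h.orth y hy _) hc (h.norm y hy) ?_⟩
  rw [h.inner_second_fderiv hO hy, neg_lt_zero]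
  exact h.pos y hy _ (hu.ne_zero 0)

end IsConvexPatch

/-! ### Families of patches -/

theorem hasFDerivAt_slice {F : Type*} [NormedAddCommGroup F] [NormedSpace ℝ F] {J : Set ℝ}
    {O : Set V} (hO : IsOpen O) {G : ℝ × V → F}
    {t : ℝ} {y : V} (hG : DifferentiableWithinAt ℝ G (J ×ˢ O) (t, y)) (ht : t ∈ J) (hy : y ∈ O) :
    HasFDerivAt (fun y => G (t, y))
      ((fderivWithin ℝ G (J ×ˢ O) (t, y)).comp (ContinuousLinearMap.inr ℝ ℝ V)) y := by
  have h1 : HasFDerivWithinAt (fun y : V => (t, y)) (ContinuousLinearMap.inr ℝ ℝ V) O y :=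
    (hasFDerivAt_prodMk_right t y).hasFDerivWithinAt
  exact (hG.hasFDerivWithinAt.comp y h1 fun z hz => ⟨ht, hz⟩).hasFDerivAt (hO.mem_nhds hy)

theorem fderiv_slice {F : Type*} [NormedAddCommGroup F] [NormedSpace ℝ F] {J : Set ℝ}
    {O : Set V} (hO : IsOpen O) {G : ℝ × V → F}
    {t : ℝ} {y : V} (hG : DifferentiableWithinAt ℝ G (J ×ˢ O) (t, y)) (ht : t ∈ J) (hy : y ∈ O)
    (v : V) : fderiv ℝ (fun y => G (t, y)) y v = fderivWithin ℝ G (J ×ˢ O) (t, y) (0, v) := by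
  rw [(hasFDerivAt_slice hO hG ht hy).fderiv]
  simp

/-- The factor `d / |d|` is the sign of `d`, smooth because `d` does not vanish. -/
theorem contDiffOn_signed_normalize {Z : Type*} [NormedAddCommGroup Z] [NormedSpace ℝ Z] {S : Set Z}
    {d : Z → ℝ} {c : Z → E3} {m : ℕ∞} (hd : ContDiffOn ℝ m d S) (hc : ContDiffOn ℝ m c S)
    (hd0 : ∀ z ∈ S, d z ≠ 0) (hc0 : ∀ z ∈ S, c z ≠ 0) :
    ContDiffOn ℝ m (fun z => (-(d z / (|d z| * ‖c z‖)) : ℝ) • c z) S := fun z hz => by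
  have habs : ContDiffWithinAt ℝ m (fun z => |d z|) S z :=
    (contDiffAt_abs (hd0 z hz)).comp_contDiffWithinAt z (hd z hz)
  exact ((hd z hz).div (habs.mul ((hc z hz).norm ℝ (hc0 z hz)))
    (mul_ne_zero (abs_ne_zero.2 (hd0 z hz)) (norm_ne_zero_iff.2 (hc0 z hz)))).neg.smul (hc z hz)

/-- The unit normals of a smooth family of convex patches depend smoothly on all variables. -/
theorem contDiffOn_normal {J : Set ℝ} {O : Set V} (hJ : UniqueDiffOn ℝ J) (hO : IsOpen O)
    (hV : Module.finrank ℝ V = 2) {x n : ℝ × V → E3} (hx : ContDiffOn ℝ ∞ x (J ×ˢ O))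
    (h : ∀ t ∈ J, IsConvexPatch O (fun y => x (t, y)) (fun y => n (t, y))) :
    ContDiffOn ℝ ∞ n (J ×ˢ O) := by
  have hS : UniqueDiffOn ℝ (J ×ˢ O) := hJ.prod hO.uniqueDiffOn
  have : FiniteDimensional ℝ V := Module.finite_of_finrank_pos (by omega)
  let B := Module.finBasisOfFinrankEq ℝ V hV
  have hu : LinearIndependent ℝ ![B 0, B 1] := by
    have := B.linearIndependent
    convert! this using 1
    ext i
    fin_cases i <;> rfl
  set u₁ := B 0
  set u₂ := B 1
  have hD : ∀ {G : ℝ × V → E3} (v : V), ContDiffOn ℝ ∞ G (J ×ˢ O) →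
      ContDiffOn ℝ ∞ (fun z => fderivWithin ℝ G (J ×ˢ O) z (0, v)) (J ×ˢ O) := fun v hG =>
    (hG.fderivWithin hS (by norm_cast)).clm_apply contDiffOn_const
  have hd1 : ∀ {G : ℝ × V → E3}, ContDiffOn ℝ ∞ G (J ×ˢ O) → DifferentiableOn ℝ G (J ×ˢ O) :=
    fun hG => hG.differentiableOn (by simp)
  have ha := hD u₁ hx
  have hb := hD u₂ hx
  have he := hD u₁ ha
  have hc : ContDiffOn ℝ ∞ (fun z => cross (fderivWithin ℝ x (J ×ˢ O) z (0, u₁))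
      (fderivWithin ℝ x (J ×ˢ O) z (0, u₂))) (J ×ˢ O) :=
    contDiff_cross.comp_contDiffOn (ha.prodMk hb)
  have hsl : ∀ t ∈ J, ∀ y ∈ O, ∀ v, fderiv ℝ (fun y => x (t, y)) y v =
      fderivWithin ℝ x (J ×ˢ O) (t, y) (0, v) := fun t ht y hy v =>
    fderiv_slice hO (hd1 hx _ ⟨ht, hy⟩) ht hy v
  have hsl2 : ∀ t ∈ J, ∀ y ∈ O, fderiv ℝ (fderiv ℝ fun y => x (t, y)) y u₁ u₁ =
      fderivWithin ℝ (fun z => fderivWithin ℝ x (J ×ˢ O) z (0, u₁)) (J ×ˢ O) (t, y) (0, u₁) :=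
    fun t ht y hy => by
      have hd : DifferentiableAt ℝ (fderiv ℝ fun y => x (t, y)) y :=
        (((h t ht).smooth.fderiv_of_isOpen hO (m := 1) (by norm_cast)).differentiableOn
          one_ne_zero).differentiableAt (hO.mem_nhds hy)
      have heq : (fun y => fderivWithin ℝ x (J ×ˢ O) (t, y) (0, u₁)) =ᶠ[𝓝 y]
          fun y' => fderiv ℝ (fun y => x (t, y)) y' u₁ := by
        filter_upwards [hO.mem_nhds hy] with z hz using (hsl t ht z hz u₁).symm
      rw [← fderiv_slice hO (hd1 ha _ ⟨ht, hy⟩) ht hy, heq.fderiv_eq,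
        fderiv_clm_apply hd (differentiableAt_const u₁)]
      simp
  have key : ∀ z ∈ J ×ˢ O, _ := fun z hz => (h z.1 hz.1).normal_eq hO hu hz.2
  refine (contDiffOn_signed_normalize (he.inner ℝ hc) hc (fun z hz => ?_) fun z hz => ?_).congr
    fun z hz => ?_
  all_goals
    obtain ⟨hc0, hd0, hn⟩ := key z hz
    rw [hsl z.1 hz.1 z.2 hz.2, hsl z.1 hz.1 z.2 hz.2] at hc0
    rw [hsl2 z.1 hz.1 z.2 hz.2, hsl z.1 hz.1 z.2 hz.2, hsl z.1 hz.1 z.2 hz.2] at hd0 hn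
    first | exact hd0 | exact hc0 | exact hn

end Patch

/-! ### From the sphere to parametrized patches -/

/-- The model space of the sphere. -/
abbrev E2 : Type := EuclideanSpace ℝ (Fin 2)

theorem finrank_E2 : Module.finrank ℝ E2 = 2 := by simp

/-- The derivative is zero by default where it does not exist. Positivity of the second fundamental
form therefore already forces the normal to be differentiable. -/
theorem mdifferentiableAt_of_mvfderiv_ne_zero {Y : S2 → E3} {p : S2} (h : diffAt Y p ≠ 0) :
    MDifferentiableAt (𝓡 2) 𝓘(ℝ, E3) Y p := by
  by_contra hY
  apply h
  simp [diffAt, mvfderiv, mfderiv_zero_of_not_mdifferentiableAt hY]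

/-- The derivative of the inverse of a chart. -/
def chartSymmDeriv (p₀ : S2) {y : E2} (hy : y ∈ (chartAt E2 p₀).target) :
    E2 ≃L[ℝ] TangentSpace (𝓡 2) ((chartAt E2 p₀).symm y) :=
  (mdifferentiable_chart (I := 𝓡 2) p₀).symm.mfderiv hy

theorem hasFDerivAt_comp_chart_symm {Y : S2 → E3} (p₀ : S2) {y : E2}
    (hy : y ∈ (chartAt E2 p₀).target)
    (hY : MDifferentiableAt (𝓡 2) 𝓘(ℝ, E3) Y ((chartAt E2 p₀).symm y)) :
    HasFDerivAt (fun y => Y ((chartAt E2 p₀).symm y))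
      ((diffAt Y ((chartAt E2 p₀).symm y)).comp
        (chartSymmDeriv p₀ hy : E2 →L[ℝ] TangentSpace (𝓡 2) ((chartAt E2 p₀).symm y))) y := by
  have h1 := ((mdifferentiable_chart (I := 𝓡 2) p₀).symm.mdifferentiableAt hy).hasMFDerivAt
  have h2 := hY.hasMFDerivAt.comp y h1
  rw [hasMFDerivAt_iff_hasFDerivAt] at h2
  exact h2

theorem IsConvexEmbedding.mdifferentiableAt_normal {Y N : S2 → E3} (h : IsConvexEmbedding Y N)
    (p : S2) : MDifferentiableAt (𝓡 2) 𝓘(ℝ, E3) N p := by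
  apply mdifferentiableAt_of_mvfderiv_ne_zero
  intro h0
  obtain ⟨v, hv⟩ : ∃ v : E2, v ≠ 0 := exists_ne 0
  have := h.secondFundamentalForm_pos p (show TangentSpace (𝓡 2) p from v) hv
  rw [h0] at this
  exact this.ne' (inner_zero_right _)

theorem IsConvexEmbedding.mdifferentiableAt {Y N : S2 → E3} (h : IsConvexEmbedding Y N)
    (p : S2) : MDifferentiableAt (𝓡 2) 𝓘(ℝ, E3) Y p :=
  h.smooth.mdifferentiable (by simp) p

theorem IsConvexEmbedding.isConvexPatch {Y N : S2 → E3} (h : IsConvexEmbedding Y N) (p₀ : S2) :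
    IsConvexPatch (chartAt E2 p₀).target (fun y => Y ((chartAt E2 p₀).symm y))
      (fun y => N ((chartAt E2 p₀).symm y)) where
  smooth := contMDiffOn_iff_contDiffOn.1
    (h.smooth.comp_contMDiffOn (contMDiffOn_chart_symm (I := 𝓡 2) (x := p₀) (n := ∞)))
  differentiable y hy :=
    (hasFDerivAt_comp_chart_symm p₀ hy (h.mdifferentiableAt_normal _)).differentiableAt
  norm y _ := h.norm_normal _
  orth y hy v := by
    rw [(hasFDerivAt_comp_chart_symm p₀ hy (h.mdifferentiableAt _)).fderiv]
    exact h.normal_orthogonal _ _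
  pos y hy v hv := by
    rw [(hasFDerivAt_comp_chart_symm p₀ hy (h.mdifferentiableAt _)).fderiv,
      (hasFDerivAt_comp_chart_symm p₀ hy (h.mdifferentiableAt_normal _)).fderiv]
    exact h.secondFundamentalForm_pos _ _
      (by simpa using (chartSymmDeriv p₀ hy).map_ne_zero_iff.2 hv)

theorem IsConvexEmbedding.radiiOfCurvature_eq {Y N : S2 → E3} (h : IsConvexEmbedding Y N)
    (p₀ : S2) {y : E2} (hy : y ∈ (chartAt E2 p₀).target) :
    radiiOfCurvature Y N ((chartAt E2 p₀).symm y) =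
      {r : ℝ | ∃ v, v ≠ 0 ∧ fderiv ℝ (fun y => Y ((chartAt E2 p₀).symm y)) y v =
        r • fderiv ℝ (fun y => N ((chartAt E2 p₀).symm y)) y v} := by
  rw [(hasFDerivAt_comp_chart_symm p₀ hy (h.mdifferentiableAt _)).fderiv,
    (hasFDerivAt_comp_chart_symm p₀ hy (h.mdifferentiableAt_normal _)).fderiv]
  ext r
  constructor
  · rintro ⟨v, hv, hr⟩
    refine ⟨(chartSymmDeriv p₀ hy).symm v, ?_, ?_⟩
    · exact (chartSymmDeriv p₀ hy).symm.map_ne_zero_iff.2 hv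
    · simpa using hr
  · rintro ⟨v, hv, hr⟩
    exact ⟨chartSymmDeriv p₀ hy v, (chartSymmDeriv p₀ hy).map_ne_zero_iff.2 hv, hr⟩

/-- In a chart, the radii of curvature are the simultaneous eigenvalues of the differentials of the
position and the normal. -/
theorem IsConvexEmbedding.exists_isPrincipal {Y N : S2 → E3} (h : IsConvexEmbedding Y N)
    (p₀ : S2) {y : E2} (hy : y ∈ (chartAt E2 p₀).target) :
    ∃ b₁ b₂, IsPrincipal
      (fderiv ℝ (fun y => Y ((chartAt E2 p₀).symm y)) y : E2 →ₗ[ℝ] E3)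
      (fderiv ℝ (fun y => N ((chartAt E2 p₀).symm y)) y : E2 →ₗ[ℝ] E3)
      (r₁ Y N ((chartAt E2 p₀).symm y)) (r₂ Y N ((chartAt E2 p₀).symm y)) b₁ b₂ := by
  obtain ⟨ρ₁, ρ₂, b₁, b₂, hb⟩ :=
    (h.isConvexPatch p₀).exists_isPrincipal (chartAt E2 p₀).open_target finrank_E2 hy
  have h1 : r₁ Y N ((chartAt E2 p₀).symm y) = ρ₁ := by
    rw [r₁, h.radiiOfCurvature_eq p₀ hy]
    exact hb.sSup_eq
  have h2 : r₂ Y N ((chartAt E2 p₀).symm y) = ρ₂ := by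
    rw [r₂, h.radiiOfCurvature_eq p₀ hy]
    exact hb.sInf_eq
  rw [h1, h2]
  exact ⟨b₁, b₂, hb⟩

theorem IsConvexEmbedding.rocDiagram_mem {Y N : S2 → E3} (h : IsConvexEmbedding Y N) (p : S2) :
    rocDiagram Y N p ∈ rocSpace := by
  have hp : (chartAt E2 p).symm (chartAt E2 p p) = p :=
    (chartAt E2 p).left_inv (mem_chart_source E2 p)
  have hy : chartAt E2 p p ∈ (chartAt E2 p).target := mem_chart_target E2 p
  obtain ⟨b₁, b₂, hb⟩ := h.exists_isPrincipal p hy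
  have hpos := (h.isConvexPatch p).pos _ hy b₂ (by
    rintro rfl
    simpa using hb.norm₂)
  have he := hb.eigen₂
  have hn := hb.norm₂
  have hle := hb.le
  simp only [ContinuousLinearMap.coe_coe] at he hn
  rw [he, inner_smul_left, real_inner_self_eq_norm_sq, hn] at hpos
  rw [hp] at hle hpos
  simp only [conj_trivial, one_pow, mul_one] at hpos
  constructor
  · simp only [rocDiagram]
    linarith
  · simp only [rocDiagram]
    linarith

/-! ### Curvature flows in a chart -/

namespace IsClassicalCurvatureFlow

variable {K : ℝ × ℝ → ℝ} {t₁ : ℝ} {X N : ℝ → S2 → E3}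

theorem contDiffOn_position (h : IsClassicalCurvatureFlow K t₁ X N) (p₀ : S2) :
    ContDiffOn ℝ ∞ (fun z : ℝ × E2 => X z.1 ((chartAt E2 p₀).symm z.2))
      (Ico 0 t₁ ×ˢ (chartAt E2 p₀).target) := by
  rw [← contMDiffOn_iff_contDiffOn]
  have h1 : ContMDiffOn 𝓘(ℝ, ℝ × E2) 𝓘(ℝ, ℝ) ∞ (fun z : ℝ × E2 => z.1)
      (Ico 0 t₁ ×ˢ (chartAt E2 p₀).target) := contDiff_fst.contMDiff.contMDiffOn
  have h2 : ContMDiffOn 𝓘(ℝ, ℝ × E2) 𝓘(ℝ, E2) ∞ (fun z : ℝ × E2 => z.2)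
      (Ico 0 t₁ ×ˢ (chartAt E2 p₀).target) := contDiff_snd.contMDiff.contMDiffOn
  have h3 := (contMDiffOn_chart_symm (I := 𝓡 2) (x := p₀) (n := ∞)).comp h2 fun z hz => hz.2
  exact h.smooth.comp (h1.prodMk h3) fun z hz => ⟨hz.1, mem_univ _⟩

theorem contDiffOn_normal (h : IsClassicalCurvatureFlow K t₁ X N) (p₀ : S2) :
    ContDiffOn ℝ ∞ (fun z : ℝ × E2 => N z.1 ((chartAt E2 p₀).symm z.2))
      (Ico 0 t₁ ×ˢ (chartAt E2 p₀).target) :=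
  CurvatureFlow.contDiffOn_normal (uniqueDiffOn_Ico 0 t₁) (chartAt E2 p₀).open_target finrank_E2
    (h.contDiffOn_position p₀) fun t ht => (h.convexEmbedding t ht).isConvexPatch p₀

theorem inner_velocity (h : IsClassicalCurvatureFlow K t₁ X N) {t : ℝ} (ht : t ∈ Ico 0 t₁)
    (p : S2) : inner ℝ (derivWithin (fun τ => X τ p) (Ico 0 t₁) t) (N t p) =
      -K (rocDiagram (X t) (N t) p) := by
  have hN : N t p ≠ 0 := by
    rw [← norm_ne_zero_iff, (h.convexEmbedding t ht).norm_normal]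
    exact one_ne_zero
  exact smul_left_injective ℝ hN (h.normal_velocity t ht p)

end IsClassicalCurvatureFlow

/-! ### The support function as a function of time and a direction -/

section Support

variable {V : Type*} [NormedAddCommGroup V] [NormedSpace ℝ V]

theorem fderiv_slice_of_isOpen {F : Type*} [NormedAddCommGroup F] [NormedSpace ℝ F] {J : Set ℝ}
    {O : Set V} (hJ : IsOpen J) (hO : IsOpen O) {G : ℝ × V → F} (hG : ContDiffOn ℝ ∞ G (J ×ˢ O))
    {q : ℝ × V} (hq : q ∈ J ×ˢ O) (v : V) :
    fderiv ℝ G q (0, v) = fderiv ℝ (fun y => G (q.1, y)) q.2 v := by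
  rw [fderiv_slice hO (hG.differentiableOn (by simp) q hq) hq.1 hq.2,
    fderivWithin_of_isOpen (hJ.prod hO) hq]

/-- A smooth family of convex patches is locally parametrized by time, the (unnormalized) normal
direction being the other coordinate: `z ↦ Ψ z` inverts `(t, y, ρ) ↦ (t, ρ • n (t, y))`. -/
theorem exists_gauss_inverse (hV : Module.finrank ℝ V = 2) {J : Set ℝ} {O : Set V}
    (hJ : IsOpen J) (hO : IsOpen O) {x n : ℝ × V → E3}
    (hn : ContDiffOn ℝ ∞ n (J ×ˢ O))
    (h : ∀ t ∈ J, IsConvexPatch O (fun y => x (t, y)) (fun y => n (t, y)))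
    {t₀ : ℝ} {y₀ : V} (ht₀ : t₀ ∈ J) (hy₀ : y₀ ∈ O) :
    ∃ (U : Set (ℝ × E3)) (Ψ : ℝ × E3 → ℝ × V × ℝ), IsOpen U ∧ (t₀, n (t₀, y₀)) ∈ U ∧
      ContDiffOn ℝ 4 Ψ U ∧ Ψ (t₀, n (t₀, y₀)) = (t₀, y₀, 1) ∧
      ∀ z ∈ U, (Ψ z).1 ∈ J ∧ (Ψ z).2.1 ∈ O ∧ 0 < (Ψ z).2.2 ∧
        ((Ψ z).1, (Ψ z).2.2 • n ((Ψ z).1, (Ψ z).2.1)) = z := by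
  have : FiniteDimensional ℝ V := Module.finite_of_finrank_pos (by omega)
  have : CompleteSpace V := FiniteDimensional.complete ℝ V
  have hS : IsOpen (J ×ˢ O) := hJ.prod hO
  set a : ℝ × V × ℝ := (t₀, y₀, 1) with ha
  let π : ℝ × V × ℝ →L[ℝ] ℝ × V :=
    (ContinuousLinearMap.fst ℝ ℝ (V × ℝ)).prod
      ((ContinuousLinearMap.fst ℝ V ℝ).comp (ContinuousLinearMap.snd ℝ ℝ (V × ℝ)))
  let σ : ℝ × V × ℝ →L[ℝ] ℝ :=
    (ContinuousLinearMap.snd ℝ V ℝ).comp (ContinuousLinearMap.snd ℝ ℝ (V × ℝ))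
  set Φ : ℝ × V × ℝ → ℝ × E3 := fun q => (q.1, σ q • n (π q)) with hΦ
  have hnat : ContDiffAt ℝ ∞ n (π a) := hn.contDiffAt (hS.mem_nhds ⟨ht₀, hy₀⟩)
  have hΦc : ContDiffAt ℝ 4 Φ a := by
    refine contDiffAt_fst.prodMk (ContDiffAt.smul σ.contDiff.contDiffAt ?_)
    exact (hnat.of_le (by norm_cast)).comp a π.contDiff.contDiffAt
  have hΦd : HasFDerivAt Φ ((ContinuousLinearMap.fst ℝ ℝ (V × ℝ)).prod
      (σ a • (fderiv ℝ n (π a)).comp π + σ.smulRight (n (π a)))) a :=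
    hasFDerivAt_fst.prodMk (σ.hasFDerivAt.smul
      ((hnat.differentiableAt (by simp)).hasFDerivAt.comp a π.hasFDerivAt))
  set L := (ContinuousLinearMap.fst ℝ ℝ (V × ℝ)).prod
      (σ a • (fderiv ℝ n (π a)).comp π + σ.smulRight (n (π a))) with hL
  -- The derivative of `ρ n` splits into a tangential part `dn v` and a normal part `r n`. These
  -- vanish separately, and `dn` is injective by convexity.
  have hinj : Function.Injective L := by
    rw [injective_iff_map_eq_zero]
    rintro ⟨τ, v, r⟩ hq
    have h1 : τ = 0 := congrArg Prod.fst hq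
    have h2 : (1 : ℝ) • fderiv ℝ n (t₀, y₀) (τ, v) + r • n (t₀, y₀) = 0 := congrArg Prod.snd hq
    rw [h1, one_smul, fderiv_slice_of_isOpen hJ hO hn ⟨ht₀, hy₀⟩] at h2
    have h3 := congrArg (fun z => inner ℝ z (n (t₀, y₀))) h2
    simp only [inner_add_left, inner_smul_left, (h t₀ ht₀).orth_normal hO hy₀, inner_zero_left,
      real_inner_self_eq_norm_sq, (h t₀ ht₀).norm y₀ hy₀] at h3
    have hr : r = 0 := by simpa using h3
    rw [hr, zero_smul, add_zero] at h2
    have hv := (injective_iff_map_eq_zero _).1 ((h t₀ ht₀).fderiv_normal_injective hy₀) v h2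
    simp [h1, hr, hv]
  have hdim : Module.finrank ℝ (ℝ × V × ℝ) = Module.finrank ℝ (ℝ × E3) := by
    simp [Module.finrank_prod, hV]
  let L' : (ℝ × V × ℝ) ≃L[ℝ] (ℝ × E3) :=
    (LinearEquiv.ofInjectiveOfFinrankEq (L : (ℝ × V × ℝ) →ₗ[ℝ] (ℝ × E3)) hinj
      hdim).toContinuousLinearEquiv
  have hL' : (L' : (ℝ × V × ℝ) →L[ℝ] (ℝ × E3)) = L := by
    ext q <;> rfl
  rw [← hL'] at hΦd
  have h4 : (4 : WithTop ℕ∞) ≠ 0 := by norm_num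
  set Ψ := hΦc.localInverse hΦd h4 with hΨ
  have hΦa : Φ a = (t₀, n (t₀, y₀)) := by
    simp [hΦ, ha, σ, π]
  have hΨa : Ψ (t₀, n (t₀, y₀)) = a := by
    rw [← hΦa]
    exact hΦc.localInverse_apply_image hΦd h4
  have hΨc : ContDiffAt ℝ 4 Ψ (t₀, n (t₀, y₀)) := by
    rw [← hΦa]
    exact hΦc.to_localInverse hΦd h4
  have hright : ∀ᶠ z in 𝓝 (t₀, n (t₀, y₀)), Φ (Ψ z) = z := by
    rw [← hΦa]
    exact (hΦc.hasStrictFDerivAt' hΦd h4).eventually_right_inverse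
  have hmem : ∀ᶠ z in 𝓝 (t₀, n (t₀, y₀)), Ψ z ∈ J ×ˢ O ×ˢ Ioi (0 : ℝ) := by
    refine hΨc.continuousAt.eventually ((hJ.prod (hO.prod isOpen_Ioi)).mem_nhds ?_)
    rw [hΨa]
    exact ⟨ht₀, hy₀, one_pos (α := ℝ)⟩
  -- Being `C^k` at a point extends to a neighbourhood for finite `k`; order `4` is what the
  -- commutation of fourth derivatives requires.
  obtain ⟨U, hUsub, hU, hU₀⟩ := eventually_nhds_iff.1
    ((hΨc.eventually (by decide)).and (hright.and hmem))
  refine ⟨U, Ψ, hU, hU₀, fun z hz => (hUsub z hz).1.contDiffWithinAt, hΨa, fun z hz => ?_⟩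
  obtain ⟨-, h1, h2⟩ := hUsub z hz
  exact ⟨h2.1, h2.2.1, h2.2.2, h1⟩

/-- The support function `w (t, z)` of a smooth family of convex patches, extended to be homogeneous
in the direction `z`: its time derivative is the normal velocity and its second derivatives on the
orthogonal complement of `z` are the second fundamental form. -/
theorem exists_support_function (hV : Module.finrank ℝ V = 2) {J : Set ℝ} {O : Set V}
    (hJ : IsOpen J) (hO : IsOpen O) {x n : ℝ × V → E3} (hx : ContDiffOn ℝ ∞ x (J ×ˢ O))
    (hn : ContDiffOn ℝ ∞ n (J ×ˢ O))
    (h : ∀ t ∈ J, IsConvexPatch O (fun y => x (t, y)) (fun y => n (t, y)))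
    {t₀ : ℝ} {y₀ : V} (ht₀ : t₀ ∈ J) (hy₀ : y₀ ∈ O) :
    ∃ (U : Set (ℝ × E3)) (w : ℝ × E3 → ℝ) (Y : ℝ × E3 → V), IsOpen U ∧ (t₀, n (t₀, y₀)) ∈ U ∧
      ContDiffOn ℝ 4 w U ∧ Y (t₀, n (t₀, y₀)) = y₀ ∧
      ∀ z ∈ U, z.1 ∈ J ∧ Y z ∈ O ∧ z.2 = ‖z.2‖ • n (z.1, Y z) ∧
        dirDeriv (1, 0) w z =
          ‖z.2‖ * inner ℝ (fderiv ℝ x (z.1, Y z) (1, 0)) (n (z.1, Y z)) ∧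
        ∀ ζ : E3, inner ℝ z.2 ζ = 0 → ∃ v, fderiv ℝ (fun y => n (z.1, y)) (Y z) v = ζ ∧
          ‖z.2‖ * dirDeriv (0, ζ) (dirDeriv (0, ζ) w) z =
            inner ℝ (fderiv ℝ (fun y => x (z.1, y)) (Y z) v) ζ := by
  obtain ⟨U, Ψ, hU, hU₀, hΨ, hΨ₀, hΨU⟩ := exists_gauss_inverse hV hJ hO hn h ht₀ hy₀
  have hS : IsOpen (J ×ˢ O) := hJ.prod hO
  set q : ℝ × E3 → ℝ × V := fun z => ((Ψ z).1, (Ψ z).2.1) with hq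
  have hqS : ∀ z ∈ U, q z ∈ J ×ˢ O := fun z hz => ⟨(hΨU z hz).1, (hΨU z hz).2.1⟩
  have hqc : ContDiffOn ℝ 4 q U := hΨ.fst.prodMk hΨ.snd.fst
  have hxq : ContDiffOn ℝ 4 (fun z => x (q z)) U :=
    (hx.of_le (by norm_cast)).comp hqc hqS
  have hwc : ContDiffOn ℝ 4 (fun z : ℝ × E3 => (inner ℝ (x (q z)) z.2 : ℝ)) U :=
    hxq.inner ℝ contDiffOn_snd
  have hq1 : ∀ z ∈ U, (q z).1 = z.1 := fun z hz => congrArg Prod.fst (hΨU z hz).2.2.2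
  have hz2 : ∀ z ∈ U, (Ψ z).2.2 • n (q z) = z.2 := fun z hz => congrArg Prod.snd (hΨU z hz).2.2.2
  have hnq : ∀ z ∈ U, ‖n (q z)‖ = 1 := fun z hz => (h _ (hqS z hz).1).norm _ (hqS z hz).2
  have hnorm : ∀ z ∈ U, ‖z.2‖ = (Ψ z).2.2 := fun z hz => by
    rw [← hz2 z hz, norm_smul, hnq z hz, mul_one, Real.norm_of_nonneg (hΨU z hz).2.2.1.le]
  have hxd : ∀ z ∈ U, HasFDerivAt x (fderiv ℝ x (q z)) (q z) := fun z hz =>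
    ((hx.differentiableOn (by simp)).differentiableAt (hS.mem_nhds (hqS z hz))).hasFDerivAt
  have hnd : ∀ z ∈ U, HasFDerivAt n (fderiv ℝ n (q z)) (q z) := fun z hz =>
    ((hn.differentiableOn (by simp)).differentiableAt (hS.mem_nhds (hqS z hz))).hasFDerivAt
  have hΨd : ∀ z ∈ U, HasFDerivAt Ψ (fderiv ℝ Ψ z) z := fun z hz =>
    ((hΨ.differentiableOn (by norm_num)).differentiableAt (hU.mem_nhds hz)).hasFDerivAt
  have hqd : ∀ z ∈ U, HasFDerivAt q (fderiv ℝ q z) z := fun z hz =>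
    ((hqc.differentiableOn (by norm_num)).differentiableAt (hU.mem_nhds hz)).hasFDerivAt
  have hqt : ∀ z ∈ U, ∀ ξ, (fderiv ℝ q z ξ).1 = ξ.1 := fun z hz ξ => by
    have h1 : HasFDerivAt (fun z => (q z).1) ((ContinuousLinearMap.fst ℝ ℝ V).comp (fderiv ℝ q z)) z :=
      (hqd z hz).fst
    have h2 : HasFDerivAt (fun z => (q z).1) (ContinuousLinearMap.fst ℝ ℝ E3) z :=
      hasFDerivAt_fst.congr_of_eventuallyEq (by
        filter_upwards [hU.mem_nhds hz] with z' hz' using hq1 z' hz')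
    exact congrArg (fun f => f ξ) (h1.unique h2)
  have hsplit : ∀ z ∈ U, ∀ τ v, inner ℝ (fderiv ℝ x (q z) (τ, v)) (n (q z)) =
      τ * (inner ℝ (fderiv ℝ x (q z) (1, 0)) (n (q z)) : ℝ) := fun z hz τ v => by
    have h1 : ((τ, v) : ℝ × V) = τ • ((1 : ℝ), (0 : V)) + ((0 : ℝ), v) := by simp
    have h2 := (h _ (hqS z hz).1).orth _ (hqS z hz).2 v
    rw [h1, map_add, map_smul, inner_add_left, inner_smul_left,
      fderiv_slice_of_isOpen hJ hO hx (hqS z hz), h2]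
    simp
  -- Motion of the foot point along the surface contributes nothing because `dx` is orthogonal to
  -- `n`. Hence the gradient of `w` in `z` is the position itself.
  have hwd : ∀ z ∈ U, ∀ ξ : ℝ × E3,
      fderiv ℝ (fun z : ℝ × E3 => (inner ℝ (x (q z)) z.2 : ℝ)) z ξ =
      ξ.1 * (‖z.2‖ * inner ℝ (fderiv ℝ x (q z) (1, 0)) (n (q z))) + inner ℝ (x (q z)) ξ.2 :=
    fun z hz ξ => by
      have h1 : HasFDerivAt (fun z => x (q z)) ((fderiv ℝ x (q z)).comp (fderiv ℝ q z)) z :=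
        (hxd z hz).comp z (hqd z hz)
      rw [(h1.inner ℝ hasFDerivAt_snd).fderiv]
      simp only [ContinuousLinearMap.comp_apply, ContinuousLinearMap.prod_apply,
        fderivInnerCLM_apply, ContinuousLinearMap.coe_snd']
      have h2 : fderiv ℝ q z ξ = (ξ.1, (fderiv ℝ q z ξ).2) := by
        rw [← hqt z hz ξ]
      rw [h2]
      conv_lhs => rw [← hz2 z hz]
      rw [inner_smul_right, hsplit z hz, hnorm z hz]
      ring
  refine ⟨U, fun z => inner ℝ (x (q z)) z.2, fun z => (q z).2, hU, hU₀, hwc, by simp [hq, hΨ₀],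
    fun z hz => ?_⟩
  have hqz : (z.1, (q z).2) = q z := by rw [← hq1 z hz]
  refine ⟨hq1 z hz ▸ (hqS z hz).1, (hqS z hz).2, ?_, ?_, fun ζ hζ => ?_⟩
  · rw [hqz, hnorm z hz, hz2 z hz]
  · rw [hqz]
    simpa [dirDeriv] using hwd z hz (1, 0)
  · have hρ := (hΨU z hz).2.2.1
    have h1 : dirDeriv (0, ζ) (dirDeriv (0, ζ) fun z => inner ℝ (x (q z)) z.2) z =
        inner ℝ (fderiv ℝ x (q z) (fderiv ℝ q z (0, ζ))) ζ := by
      have h2 : EqOn (dirDeriv (0, ζ) fun z : ℝ × E3 => (inner ℝ (x (q z)) z.2 : ℝ))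
          (fun z => inner ℝ (x (q z)) ζ) U := fun z' hz' => by
        simpa [dirDeriv] using hwd z' hz' (0, ζ)
      rw [dirDeriv_congr hU h2 _ hz]
      have h3 : HasFDerivAt (fun z => x (q z)) ((fderiv ℝ x (q z)).comp (fderiv ℝ q z)) z :=
        (hxd z hz).comp z (hqd z hz)
      simp only [dirDeriv]
      rw [fderiv_inner_apply ℝ h3.differentiableAt (differentiableAt_const ζ), h3.fderiv]
      simp
    set v₀ := (fderiv ℝ q z (0, ζ)).2 with hv₀
    have h2 : fderiv ℝ q z (0, ζ) = (0, v₀) := by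
      exact Prod.ext (hqt z hz (0, ζ)) rfl
    have h3 : HasFDerivAt (fun z => (Ψ z).2.2 • n (q z))
        ((Ψ z).2.2 • (fderiv ℝ n (q z)).comp (fderiv ℝ q z) +
          (fderiv ℝ (fun z => (Ψ z).2.2) z).smulRight (n (q z))) z :=
      ((hΨd z hz).snd.snd.differentiableAt.hasFDerivAt).smul ((hnd z hz).comp z (hqd z hz))
    have h4 : HasFDerivAt (fun z => (Ψ z).2.2 • n (q z)) (ContinuousLinearMap.snd ℝ ℝ E3) z :=
      hasFDerivAt_snd.congr_of_eventuallyEq (by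
        filter_upwards [hU.mem_nhds hz] with z' hz' using hz2 z' hz')
    have h5 := congrArg (fun f => f ((0 : ℝ), ζ)) (h3.unique h4)
    simp only [add_apply, smul_apply, ContinuousLinearMap.comp_apply,
      ContinuousLinearMap.smulRight_apply, ContinuousLinearMap.coe_snd', h2,
      fderiv_slice_of_isOpen hJ hO hn (hqS z hz)] at h5
    have horth := (h _ (hqS z hz).1).orth_normal hO (hqS z hz).2 v₀
    have hζn : inner ℝ ζ (n (q z)) = 0 := by
      rw [← hz2 z hz, inner_smul_left, real_inner_comm] at hζ
      simpa [hρ.ne'] using hζ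
    have h6 := congrArg (fun u => inner ℝ u (n (q z))) h5
    simp only [inner_add_left, inner_smul_left] at h6
    rw [horth, hζn, real_inner_self_eq_norm_sq, hnq z hz] at h6
    -- For `ζ` orthogonal to the normal the radius `ρ` is stationary, so differentiating `ρ n = z`
    -- leaves `ρ dn(v₀) = ζ`; the required preimage is `ρ v₀`.
    have h7 : fderiv ℝ (fun z => (Ψ z).2.2) z (0, ζ) = 0 := by simpa using h6
    rw [h7, zero_smul, add_zero] at h5
    rw [← hq1 z hz]
    refine ⟨(Ψ z).2.2 • v₀, ?_, ?_⟩
    · rw [map_smul]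
      exact h5
    · rw [h1, h2, fderiv_slice_of_isOpen hJ hO hx (hqS z hz), map_smul, inner_smul_left, hnorm z hz]
      simp

end Support

/-! ### The maximum principle for curvature flows -/

namespace IsClassicalCurvatureFlow

variable {K : ℝ × ℝ → ℝ} {t₁ : ℝ} {X N : ℝ → S2 → E3}

theorem fderiv_position_time (h : IsClassicalCurvatureFlow K t₁ X N) (p₀ : S2) {t : ℝ}
    (ht : t ∈ Ioo 0 t₁) {y : E2} (hy : y ∈ (chartAt E2 p₀).target) :
    fderiv ℝ (fun z : ℝ × E2 => X z.1 ((chartAt E2 p₀).symm z.2)) (t, y) (1, 0) =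
      derivWithin (fun τ => X τ ((chartAt E2 p₀).symm y)) (Ico 0 t₁) t := by
  have hnhds : Ico 0 t₁ ∈ 𝓝 t := Ico_mem_nhds ht.1 ht.2
  have h1 : DifferentiableAt ℝ (fun z : ℝ × E2 => X z.1 ((chartAt E2 p₀).symm z.2)) (t, y) :=
    ((h.contDiffOn_position p₀).differentiableOn (by simp)).differentiableAt
      (prod_mem_nhds hnhds ((chartAt E2 p₀).open_target.mem_nhds hy))
  have h2 : HasDerivAt (fun τ : ℝ => ((τ, y) : ℝ × E2)) (1, 0) t :=
    (hasDerivAt_id t).prodMk (hasDerivAt_const t y)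
  rw [derivWithin_of_mem_nhds hnhds]
  exact (h1.hasFDerivAt.comp_hasDerivAt t h2).deriv.symm

/-- The local support function of a curvature flow in an orthonormal frame of principal directions
and normal at a given point. -/
theorem exists_support_frame (h : IsClassicalCurvatureFlow K t₁ X N) {t₀ : ℝ}
    (ht₀ : t₀ ∈ Ioo 0 t₁) (p₀ : S2) :
    ∃ (U : Set (ℝ × E3)) (w : ℝ × E3 → ℝ) (P : ℝ × E3 → S2) (e₁ e₂ n : E3),
      IsOpen U ∧ ContDiffOn ℝ 4 w U ∧ ‖e₁‖ = 1 ∧ ‖e₂‖ = 1 ∧ ‖n‖ = 1 ∧ inner ℝ e₁ e₂ = 0 ∧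
      inner ℝ n e₁ = 0 ∧ inner ℝ n e₂ = 0 ∧ (t₀, n) ∈ U ∧ P (t₀, n) = p₀ ∧
      (∀ z ∈ U, z.1 ∈ Ioo 0 t₁) ∧
      (∀ z ∈ U, dirDeriv (1, 0) w z = -(‖z.2‖ * K (rocDiagram (X z.1) (N z.1) (P z)))) ∧
      (∀ z ∈ U, ∀ ζ : E3, ‖ζ‖ = 1 → inner ℝ z.2 ζ = 0 →
        r₂ (X z.1) (N z.1) (P z) ≤ ‖z.2‖ * dirDeriv (0, ζ) (dirDeriv (0, ζ) w) z ∧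
        ‖z.2‖ * dirDeriv (0, ζ) (dirDeriv (0, ζ) w) z ≤ r₁ (X z.1) (N z.1) (P z)) ∧
      (∀ t, (t, n) ∈ U → r₁ (X t) (N t) (P (t, n)) + r₂ (X t) (N t) (P (t, n)) =
        dirDeriv (0, e₁) (dirDeriv (0, e₁) w) (t, n) +
          dirDeriv (0, e₂) (dirDeriv (0, e₂) w) (t, n)) ∧
      r₁ (X t₀) (N t₀) p₀ = dirDeriv (0, e₁) (dirDeriv (0, e₁) w) (t₀, n) := by
  set φ := chartAt E2 p₀ with hφ
  have hJ : Ioo 0 t₁ ⊆ Ico 0 t₁ := Ioo_subset_Ico_self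
  have hx := (h.contDiffOn_position p₀).mono (prod_mono hJ (Subset.refl φ.target))
  have hn := (h.contDiffOn_normal p₀).mono (prod_mono hJ (Subset.refl φ.target))
  have hpatch : ∀ t ∈ Ioo 0 t₁, IsConvexPatch φ.target (fun y => X t (φ.symm y))
      (fun y => N t (φ.symm y)) := fun t ht => (h.convexEmbedding t (hJ ht)).isConvexPatch p₀
  have hy₀ : φ p₀ ∈ φ.target := mem_chart_target E2 p₀
  have hp₀ : φ.symm (φ p₀) = p₀ := φ.left_inv (mem_chart_source E2 p₀)
  obtain ⟨U, w, Y, hU, hU₀, hw, hY₀, hUz⟩ := exists_support_function finrank_E2 isOpen_Ioo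
    φ.open_target hx hn hpatch ht₀ hy₀
  simp only [← hφ] at hU₀ hY₀ hUz
  have hprin : ∀ z ∈ U, ∃ b₁ b₂, IsPrincipal
      (fderiv ℝ (fun y => X z.1 (φ.symm y)) (Y z) : E2 →ₗ[ℝ] E3)
      (fderiv ℝ (fun y => N z.1 (φ.symm y)) (Y z) : E2 →ₗ[ℝ] E3)
      (r₁ (X z.1) (N z.1) (φ.symm (Y z))) (r₂ (X z.1) (N z.1) (φ.symm (Y z))) b₁ b₂ := fun z hz =>
    (h.convexEmbedding z.1 (hJ (hUz z hz).1)).exists_isPrincipal p₀ (hUz z hz).2.1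
  obtain ⟨b₁, b₂, hb⟩ := hprin _ hU₀
  simp only [hY₀] at hb
  have hnorm₁ := hb.norm₁
  have hnorm₂ := hb.norm₂
  have horth := hb.orth
  have heig := hb.eigen₁
  simp only [ContinuousLinearMap.coe_coe] at hnorm₁ hnorm₂ horth heig
  set e₁ := fderiv ℝ (fun y => N t₀ (φ.symm y)) (φ p₀) b₁
  set e₂ := fderiv ℝ (fun y => N t₀ (φ.symm y)) (φ p₀) b₂
  set n := N t₀ (φ.symm (φ p₀)) with hn_def
  have hnn : ‖n‖ = 1 := (h.convexEmbedding t₀ (hJ ht₀)).norm_normal _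
  have hne : ∀ b, inner ℝ n (fderiv ℝ (fun y => N t₀ (φ.symm y)) (φ p₀) b) = 0 := fun b => by
    rw [real_inner_comm]
    exact (hpatch t₀ ht₀).orth_normal φ.open_target hy₀ b
  refine ⟨U, w, fun z => φ.symm (Y z), e₁, e₂, n, hU, hw, hnorm₁, hnorm₂, hnn, horth, hne b₁,
    hne b₂, hU₀, by simp only [hY₀, hp₀], fun z hz => (hUz z hz).1, fun z hz => ?_,
    fun z hz ζ hζ hzζ => ?_, fun t ht => ?_, ?_⟩
  · obtain ⟨hz1, hzY, -, hzt, -⟩ := hUz z hz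
    rw [hzt, h.fderiv_position_time p₀ hz1 hzY, h.inner_velocity (hJ hz1)]
    ring
  · obtain ⟨v, hv, hvw⟩ := (hUz z hz).2.2.2.2 ζ hzζ
    obtain ⟨c₁, c₂, hc⟩ := hprin z hz
    have := hc.rayleigh (v := v) (by simpa only [ContinuousLinearMap.coe_coe, hv] using hζ)
    simp only [ContinuousLinearMap.coe_coe, hv] at this
    rwa [hvw]
  -- The frame `e₁, e₂` is chosen principal at `t₀`, but the normal `n` stays fixed as `t` varies,
  -- so the frame still spans the tangent plane and computes the trace.
  · obtain ⟨v₁, hv₁, hvw₁⟩ := (hUz _ ht).2.2.2.2 e₁ (hne b₁)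
    obtain ⟨v₂, hv₂, hvw₂⟩ := (hUz _ ht).2.2.2.2 e₂ (hne b₂)
    obtain ⟨c₁, c₂, hc⟩ := hprin _ ht
    have := hc.trace_eq (v := v₁) (w := v₂)
      (by simpa only [ContinuousLinearMap.coe_coe, hv₁] using hnorm₁)
      (by simpa only [ContinuousLinearMap.coe_coe, hv₂] using hnorm₂)
      (by simpa only [ContinuousLinearMap.coe_coe, hv₁, hv₂] using horth)
    simp only [ContinuousLinearMap.coe_coe, hv₁, hv₂] at this
    simp only [hnn, one_mul] at hvw₁ hvw₂
    rw [hvw₁, hvw₂]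
    exact this
  · obtain ⟨v₁, hv₁, hvw₁⟩ := (hUz _ hU₀).2.2.2.2 e₁ (hne b₁)
    simp only [hnn, one_mul, hY₀] at hv₁ hvw₁
    have : v₁ = b₁ := (hpatch t₀ ht₀).fderiv_normal_injective hy₀ hv₁
    rw [hvw₁, this, heig, inner_smul_left, real_inner_self_eq_norm_sq, hnorm₁, hp₀]
    simp

/-- The radii of curvature diagram of a curvature flow is continuous, up to the initial time. -/
theorem continuousOn_rocDiagram (h : IsClassicalCurvatureFlow K t₁ X N) :
    ContinuousOn (fun q : ℝ × S2 => rocDiagram (X q.1) (N q.1) q.2) (Ico 0 t₁ ×ˢ univ) := by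
  rintro ⟨t₀, p₀⟩ ⟨ht₀, -⟩
  set φ := chartAt E2 p₀ with hφ
  set S := Ico 0 t₁ ×ˢ φ.target with hS_def
  have hS : UniqueDiffOn ℝ S := (uniqueDiffOn_Ico 0 t₁).prod φ.open_target.uniqueDiffOn
  have hx := h.contDiffOn_position p₀
  have hn := h.contDiffOn_normal p₀
  let B := Module.finBasisOfFinrankEq ℝ E2 finrank_E2
  have hu : LinearIndependent ℝ ![B 0, B 1] := by
    have := B.linearIndependent
    convert! this using 1
    ext i
    fin_cases i <;> rfl
  set u := B 0
  set v := B 1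
  set dx : E2 → ℝ × E2 → E3 := fun b z =>
    fderivWithin ℝ (fun z : ℝ × E2 => X z.1 (φ.symm z.2)) S z (0, b)
  set dn : E2 → ℝ × E2 → E3 := fun b z =>
    fderivWithin ℝ (fun z : ℝ × E2 => N z.1 (φ.symm z.2)) S z (0, b)
  have hdx : ∀ b, ContinuousOn (dx b) S := fun b =>
    (hx.continuousOn_fderivWithin hS (by simp)).clm_apply continuousOn_const
  have hdn : ∀ b, ContinuousOn (dn b) S := fun b =>
    (hn.continuousOn_fderivWithin hS (by simp)).clm_apply continuousOn_const
  set g : ℝ × E2 → ℝ := fun z =>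
    inner ℝ (dn u z) (dn u z) * inner ℝ (dn v z) (dn v z) - inner ℝ (dn u z) (dn v z) ^ 2
  set T : ℝ × E2 → ℝ := fun z => (inner ℝ (dx u z) (dn u z) * inner ℝ (dn v z) (dn v z) +
    inner ℝ (dx v z) (dn v z) * inner ℝ (dn u z) (dn u z) -
      2 * (inner ℝ (dx u z) (dn v z) * inner ℝ (dn u z) (dn v z))) / g z
  set D : ℝ × E2 → ℝ := fun z => (inner ℝ (dx u z) (dn u z) * inner ℝ (dx v z) (dn v z) -
    inner ℝ (dx u z) (dn v z) ^ 2) / g z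
  have hg : ContinuousOn g S := (((hdn u).inner (hdn u)).mul ((hdn v).inner (hdn v))).sub
    (((hdn u).inner (hdn v)).pow 2)
  -- The half-difference of the radii is the square root of the discriminant, which is continuous
  -- also at umbilics, where it may fail to be differentiable.
  have key : ∀ z ∈ S, g z ≠ 0 ∧
      rocDiagram (X z.1) (N z.1) (φ.symm z.2) = (T z / 2, √(T z ^ 2 / 4 - D z)) := by
    rintro ⟨t, y⟩ ⟨ht, hy⟩
    obtain ⟨b₁, b₂, hb⟩ := (h.convexEmbedding t ht).exists_isPrincipal p₀ hy
    have h1 := hb.gram_ne_zero hu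
    have h2 := hb.trace_mul_gram u v
    have h3 := hb.det_mul_gram u v
    have h4 := hb.le
    have hxs : ∀ b, fderiv ℝ (fun y => X t (φ.symm y)) y b = dx b (t, y) :=
      fderiv_slice φ.open_target (hx.differentiableOn (by simp) _ ⟨ht, hy⟩) ht hy
    have hns : ∀ b, fderiv ℝ (fun y => N t (φ.symm y)) y b = dn b (t, y) :=
      fderiv_slice φ.open_target (hn.differentiableOn (by simp) _ ⟨ht, hy⟩) ht hy
    simp only [ContinuousLinearMap.coe_coe, ← hφ, hxs, hns] at h1 h2 h3 h4
    have hT : T (t, y) = r₁ (X t) (N t) (φ.symm y) + r₂ (X t) (N t) (φ.symm y) :=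
      ((eq_div_iff h1).2 h2).symm
    have hD : D (t, y) = r₁ (X t) (N t) (φ.symm y) * r₂ (X t) (N t) (φ.symm y) :=
      ((eq_div_iff h1).2 h3).symm
    refine ⟨h1, ?_⟩
    rw [hT, hD, rocDiagram]
    congr 1
    rw [← Real.sqrt_sq (by linarith :
      0 ≤ (r₁ (X t) (N t) (φ.symm y) - r₂ (X t) (N t) (φ.symm y)) / 2)]
    congr 1
    ring
  have hT : ContinuousOn T S :=
    (((((hdx u).inner (hdn u)).mul ((hdn v).inner (hdn v))).add
      (((hdx v).inner (hdn v)).mul ((hdn u).inner (hdn u)))).sub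
      (continuousOn_const.mul (((hdx u).inner (hdn v)).mul ((hdn u).inner (hdn v))))).div hg
      fun z hz => (key z hz).1
  have hD : ContinuousOn D S :=
    ((((hdx u).inner (hdn u)).mul ((hdx v).inner (hdn v))).sub
      (((hdx u).inner (hdn v)).pow 2)).div hg fun z hz => (key z hz).1
  have hG : ContinuousOn (fun z : ℝ × E2 => rocDiagram (X z.1) (N z.1) (φ.symm z.2)) S :=
    ((hT.div_const 2).prodMk (((hT.pow 2).div_const 4).sub hD).sqrt).congr
      fun z hz => (key z hz).2
  have hφc : ContinuousOn (fun q : ℝ × S2 => (q.1, φ q.2)) (Ico 0 t₁ ×ˢ φ.source) :=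
    continuousOn_fst.prodMk (φ.continuousOn.comp continuousOn_snd fun q hq => hq.2)
  have hfin : ContinuousOn (fun q : ℝ × S2 => rocDiagram (X q.1) (N q.1) q.2)
      (Ico 0 t₁ ×ˢ φ.source) :=
    (hG.comp hφc fun q hq => ⟨hq.1, φ.map_source hq.2⟩).congr fun q hq => by
      simp only [Function.comp_apply]
      rw [φ.left_inv hq.2]
  refine (hfin (t₀, p₀) ⟨ht₀, mem_chart_source E2 p₀⟩).mono_of_mem_nhdsWithin ?_
  rw [nhdsWithin_prod_eq, nhdsWithin_univ]
  exact prod_mem_prod self_mem_nhdsWithin (φ.open_source.mem_nhds (mem_chart_source E2 p₀))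

/-- No first contact from below, for a convex speed. -/
theorem not_contact_of_convex (h : IsClassicalCurvatureFlow K t₁ X N)
    (hK : ContDiffOn ℝ 2 K rocSpace) (hpar : ∀ x ∈ rocSpace, |d01 K x| < -d10 K x)
    (hK0 : ∀ x ∈ rocSpace, 0 ≤ K x) (hK2 : ∀ x ∈ rocSpace, (hess K x).PosSemidef)
    {H : ℝ × ℝ → ℝ} (hH : ContDiffOn ℝ 2 H rocSpace)
    (hH1 : ∀ x ∈ rocSpace, |d01 H x| ≤ d10 H x)
    (hH2 : ∀ x ∈ rocSpace, (hess H x).PosSemidef) (hHK : ∀ x ∈ rocSpace, 0 ≤ poisson H K x)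
    {t₀ : ℝ} (ht₀ : t₀ ∈ Ioo 0 t₁) (p₀ : S2) {ε : ℝ} (hε : 0 < ε)
    (hmax : ∀ t ∈ Icc 0 t₀, ∀ p, H (rocDiagram (X t) (N t) p) ≤
      H (rocDiagram (X t₀) (N t₀) p₀) + ε * (t - t₀)) : False := by
  obtain ⟨U, w, P, e₁, e₂, n, hU, hw, he₁, he₂, hn, h₁₂, hn₁, hn₂, h₀, hP, hUt, hκ, hR, htr,
    hbase⟩ := h.exists_support_frame ht₀ p₀
  have hmem : ∀ t ∈ Ioo 0 t₁, ∀ p, rocDiagram (X t) (N t) p ∈ rocSpace := fun t ht p =>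
    (h.convexEmbedding t ⟨ht.1.le, ht.2⟩).rocDiagram_mem p
  have hx₀ := hmem t₀ ht₀ p₀
  set x₀ := rocDiagram (X t₀) (N t₀) p₀ with hx₀_def
  obtain ⟨hk₁, hk₂⟩ := abs_lt.1 (hpar _ hx₀)
  obtain ⟨ha₁, ha₂⟩ := abs_le.1 (hH1 _ hx₀)
  have hb := hHK _ hx₀
  rw [poisson] at hb
  -- The half-sums and half-differences below are the derivatives in `r₁` and `r₂`. In these terms
  -- `a₂k₁ - a₁k₂` is half the Poisson bracket.
  refine not_first_contact hU hw he₁ he₂ hn h₁₂ hn₁ hn₂ h₀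
    (R₁ := fun z => r₁ (X z.1) (N z.1) (P z)) (R₂ := fun z => r₂ (X z.1) (N z.1) (P z))
    (κ := fun z => K (rocDiagram (X z.1) (N z.1) (P z))) hκ hR htr (by simpa only [hP] using hbase)
    (a₁ := (d10 H x₀ + d01 H x₀) / 2) (a₂ := (d10 H x₀ - d01 H x₀) / 2)
    (k₁ := (d10 K x₀ + d01 K x₀) / 2) (k₂ := (d10 K x₀ - d01 K x₀) / 2)
    (by linarith) (by linarith) (by linarith) (by linarith) (by linarith) hε ?_ ?_ ?_
  · exact hK0 _ (hmem _ ht₀ _)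
  · intro z hz
    have := le_sub_of_hess_posSemidef hK hK2 hx₀ (hmem _ (hUt z hz) (P z))
    simp only [hP, ← hx₀_def]
    refine le_trans (le_of_eq ?_) this
    simp only [hx₀_def, rocDiagram]
    ring
  · intro z hz hzt
    have h1 := le_sub_of_hess_posSemidef hH hH2 hx₀ (hmem _ (hUt z hz) (P z))
    have h2 := hmax z.1 ⟨(hUt z hz).1.le, hzt⟩ (P z)
    simp only [hP]
    refine le_trans (le_of_eq ?_) (h1.trans (sub_le_iff_le_add'.2 h2))
    simp only [hx₀_def, rocDiagram]
    ring

/-- No first contact from above, for a concave speed. -/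
theorem not_contact_of_concave (h : IsClassicalCurvatureFlow K t₁ X N)
    (hK : ContDiffOn ℝ 2 K rocSpace) (hpar : ∀ x ∈ rocSpace, |d01 K x| < -d10 K x)
    (hK0 : ∀ x ∈ rocSpace, K x ≤ 0) (hK2 : ∀ x ∈ rocSpace, (-hess K x).PosSemidef)
    {H : ℝ × ℝ → ℝ} (hH : ContDiffOn ℝ 2 H rocSpace)
    (hH1 : ∀ x ∈ rocSpace, |d01 H x| ≤ d10 H x)
    (hH2 : ∀ x ∈ rocSpace, (-hess H x).PosSemidef) (hHK : ∀ x ∈ rocSpace, poisson H K x ≤ 0)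
    {t₀ : ℝ} (ht₀ : t₀ ∈ Ioo 0 t₁) (p₀ : S2) {ε : ℝ} (hε : 0 < ε)
    (hmin : ∀ t ∈ Icc 0 t₀, ∀ p, -H (rocDiagram (X t) (N t) p) ≤
      -H (rocDiagram (X t₀) (N t₀) p₀) + ε * (t - t₀)) : False := by
  obtain ⟨U, w, P, e₁, e₂, n, hU, hw, he₁, he₂, hn, h₁₂, hn₁, hn₂, h₀, hP, hUt, hκ, hR, htr,
    hbase⟩ := h.exists_support_frame ht₀ p₀
  have hmem : ∀ t ∈ Ioo 0 t₁, ∀ p, rocDiagram (X t) (N t) p ∈ rocSpace := fun t ht p =>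
    (h.convexEmbedding t ⟨ht.1.le, ht.2⟩).rocDiagram_mem p
  have hx₀ := hmem t₀ ht₀ p₀
  set x₀ := rocDiagram (X t₀) (N t₀) p₀ with hx₀_def
  obtain ⟨hk₁, hk₂⟩ := abs_lt.1 (hpar _ hx₀)
  obtain ⟨ha₁, ha₂⟩ := abs_le.1 (hH1 _ hx₀)
  have hb := hHK _ hx₀
  rw [poisson] at hb
  have hneg : ∀ (v : ℝ × E3) (F : ℝ × E3 → ℝ),
      dirDeriv v (fun z => -F z) = fun z => -dirDeriv v F z := fun v F => by
    funext z
    simp [dirDeriv]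
  -- Negating `w` makes `-r₂ ≥ -r₁` the ordered eigenvalues and `-K` the speed. The derivatives in
  -- the two radii trade places, which flips the sign of the bracket.
  refine not_first_contact hU hw.neg he₂ he₁ hn (by rw [real_inner_comm]; exact h₁₂) hn₂ hn₁ h₀
    (R₁ := fun z => -r₂ (X z.1) (N z.1) (P z)) (R₂ := fun z => -r₁ (X z.1) (N z.1) (P z))
    (κ := fun z => -K (rocDiagram (X z.1) (N z.1) (P z)))
    (fun z hz => ?_) (fun z hz ζ hζ hzζ => ?_) (fun t ht => ?_) ?_
    (a₁ := (d10 H x₀ - d01 H x₀) / 2) (a₂ := (d10 H x₀ + d01 H x₀) / 2)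
    (k₁ := (d10 K x₀ - d01 K x₀) / 2) (k₂ := (d10 K x₀ + d01 K x₀) / 2)
    (by linarith) (by linarith) (by linarith) (by linarith) (by linarith) hε ?_ ?_ ?_
  · simp only [hneg, hκ z hz]
    ring
  · have := hR z hz ζ hζ hzζ
    simp only [hneg]
    constructor <;> linarith [this.1, this.2]
  · have := htr t ht
    simp only [hneg]
    linarith
  · have := htr t₀ h₀
    simp only [hneg, hP] at this ⊢
    linarith
  · exact neg_nonneg.2 (hK0 _ (hmem _ ht₀ _))
  · intro z hz
    have := sub_le_of_neg_hess_posSemidef hK hK2 hx₀ (hmem _ (hUt z hz) (P z))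
    simp only [hP, ← hx₀_def]
    refine le_trans (le_of_eq ?_) ((neg_le_neg this).trans_eq (by ring))
    simp only [hx₀_def, rocDiagram]
    ring
  · intro z hz hzt
    have h1 := sub_le_of_neg_hess_posSemidef hH hH2 hx₀ (hmem _ (hUt z hz) (P z))
    have h2 := hmin z.1 ⟨(hUt z hz).1.le, hzt⟩ (P z)
    simp only [hP]
    refine le_trans (le_of_eq ?_) ((neg_le_neg h1).trans
      (show _ ≤ ε * (z.1 - t₀) by linarith))
    simp only [hx₀_def, rocDiagram]
    ring

end IsClassicalCurvatureFlow

/-- The global maximum principle, from the absence of first contacts. -/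
theorem exists_isGreatest_forall_le {S : Type*} [TopologicalSpace S] [CompactSpace S] [Nonempty S]
    {t₁ : ℝ} (ht₁ : 0 < t₁) {f : ℝ → S → ℝ}
    (hf : ContinuousOn (fun q : ℝ × S => f q.1 q.2) (Ico 0 t₁ ×ˢ univ))
    (hno : ∀ t₀ ∈ Ioo 0 t₁, ∀ p₀, ∀ ε > 0,
      (∀ t ∈ Icc 0 t₀, ∀ p, f t p ≤ f t₀ p₀ + ε * (t - t₀)) → False) :
    ∃ M, IsGreatest (range (f 0)) M ∧ ∀ t ∈ Ico 0 t₁, ∀ p, f t p ≤ M := by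
  have hf0 : Continuous (f 0) := by
    rw [← continuousOn_univ]
    exact hf.comp (Continuous.prodMk_right (0 : ℝ)).continuousOn fun p _ =>
      ⟨left_mem_Ico.2 ht₁, mem_univ _⟩
  obtain ⟨q, -, hq⟩ := isCompact_univ.exists_isMaxOn univ_nonempty hf0.continuousOn
  refine ⟨f 0 q, ⟨mem_range_self q, ?_⟩, ?_⟩
  · rintro _ ⟨p, rfl⟩
    exact hq (mem_univ p)
  by_contra! hcon
  obtain ⟨s, hs, p, hp⟩ := hcon
  have hs0 : 0 < s := by
    refine lt_of_le_of_ne hs.1 ?_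
    rintro rfl
    exact absurd (hq (mem_univ p)) (not_le.2 hp)
  -- With this choice the penalty up to time `s` consumes half of the excess, so the maximum of `f -
  -- ε t` cannot occur at time `0`.
  set ε := (f s p - f 0 q) / (2 * s) with hε
  have hεpos : 0 < ε := div_pos (sub_pos.2 hp) (by positivity)
  have hεs : ε * s = (f s p - f 0 q) / 2 := by
    rw [hε]
    field_simp
  have hsub : Icc 0 s ×ˢ (univ : Set S) ⊆ Ico 0 t₁ ×ˢ univ := fun z hz =>
    ⟨⟨hz.1.1, hz.1.2.trans_lt hs.2⟩, mem_univ _⟩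
  obtain ⟨⟨t₀, p₀⟩, ⟨ht₀, -⟩, hmax⟩ := (isCompact_Icc.prod isCompact_univ).exists_isMaxOn
    ⟨(s, p), right_mem_Icc.2 hs0.le, mem_univ _⟩
    ((hf.mono hsub).sub ((continuousOn_const (c := ε)).mul continuousOn_fst))
  have hmax' : ∀ t ∈ Icc 0 s, ∀ p, f t p - ε * t ≤ f t₀ p₀ - ε * t₀ := fun t ht p =>
    hmax (show (t, p) ∈ Icc 0 s ×ˢ univ from ⟨ht, mem_univ _⟩)
  have ht₀pos : 0 < t₀ := by
    refine lt_of_le_of_ne ht₀.1 ?_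
    rintro rfl
    have h1 := hmax' s (right_mem_Icc.2 hs0.le) p
    have h2 : f 0 p₀ ≤ f 0 q := hq (mem_univ p₀)
    linarith
  refine hno t₀ ⟨ht₀pos, ht₀.2.trans_lt hs.2⟩ p₀ ε hεpos fun t ht p => ?_
  have := hmax' t ⟨ht.1, ht.2.trans ht₀.2⟩ p
  linarith

theorem nonempty_S2 : Nonempty S2 :=
  (NormedSpace.sphere_nonempty.2 zero_le_one).to_subtype

end CurvatureFlow

end

open CurvatureFlow in
theorem theorem1 (K : ℝ × ℝ → ℝ) (hK : ContDiffOn ℝ 2 K CurvatureFlow.rocSpace)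
    (t₁ : ℝ) (ht₁ : 0 < t₁) (X N : ℝ → CurvatureFlow.S2 → CurvatureFlow.E3)
    (hflow : CurvatureFlow.IsClassicalCurvatureFlow K t₁ X N)
    (hparabolic : ∀ x ∈ CurvatureFlow.rocSpace,
      |CurvatureFlow.d01 K x| < -CurvatureFlow.d10 K x) :
    ((∀ x ∈ CurvatureFlow.rocSpace, 0 ≤ K x) →
      (∀ x ∈ CurvatureFlow.rocSpace, (CurvatureFlow.hess K x).PosSemidef) →
      ∀ H : ℝ × ℝ → ℝ, ContDiffOn ℝ 2 H CurvatureFlow.rocSpace →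
      (∀ x ∈ CurvatureFlow.rocSpace, |CurvatureFlow.d01 H x| ≤ CurvatureFlow.d10 H x) →
      (∀ x ∈ CurvatureFlow.rocSpace, (CurvatureFlow.hess H x).PosSemidef) →
      (∀ x ∈ CurvatureFlow.rocSpace, 0 ≤ CurvatureFlow.poisson H K x) →
      ∃ M : ℝ, IsGreatest (Set.range fun p => H (CurvatureFlow.rocDiagram (X 0) (N 0) p)) M ∧
        ∀ t ∈ Set.Ico 0 t₁, ∀ p, H (CurvatureFlow.rocDiagram (X t) (N t) p) ≤ M) ∧
    ((∀ x ∈ CurvatureFlow.rocSpace, K x ≤ 0) →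
      (∀ x ∈ CurvatureFlow.rocSpace, (-CurvatureFlow.hess K x).PosSemidef) →
      ∀ H : ℝ × ℝ → ℝ, ContDiffOn ℝ 2 H CurvatureFlow.rocSpace →
      (∀ x ∈ CurvatureFlow.rocSpace, |CurvatureFlow.d01 H x| ≤ CurvatureFlow.d10 H x) →
      (∀ x ∈ CurvatureFlow.rocSpace, (-CurvatureFlow.hess H x).PosSemidef) →
      (∀ x ∈ CurvatureFlow.rocSpace, CurvatureFlow.poisson H K x ≤ 0) →
      ∃ m : ℝ, IsLeast (Set.range fun p => H (CurvatureFlow.rocDiagram (X 0) (N 0) p)) m ∧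
        ∀ t ∈ Set.Ico 0 t₁, ∀ p, m ≤ H (CurvatureFlow.rocDiagram (X t) (N t) p)) := by
  have := nonempty_S2
  have hcont : ∀ H : ℝ × ℝ → ℝ, ContDiffOn ℝ 2 H rocSpace → ContinuousOn
      (fun q : ℝ × S2 => H (rocDiagram (X q.1) (N q.1) q.2)) (Ico 0 t₁ ×ˢ univ) := fun H hH =>
    hH.continuousOn.comp hflow.continuousOn_rocDiagram fun q hq =>
      (hflow.convexEmbedding q.1 hq.1).rocDiagram_mem q.2
  refine ⟨fun hK0 hK2 H hH hH1 hH2 hHK => ?_, fun hK0 hK2 H hH hH1 hH2 hHK => ?_⟩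
  · exact exists_isGreatest_forall_le ht₁ (f := fun t p => H (rocDiagram (X t) (N t) p))
      (hcont H hH) fun t₀ ht₀ p₀ ε hε hmax =>
        hflow.not_contact_of_convex hK hparabolic hK0 hK2 hH hH1 hH2 hHK ht₀ p₀ hε hmax
  · obtain ⟨M, ⟨⟨q, hq⟩, hM⟩, hle⟩ := exists_isGreatest_forall_le ht₁
      (f := fun t p => -H (rocDiagram (X t) (N t) p)) (hcont H hH).neg
      fun t₀ ht₀ p₀ ε hε hmax =>
        hflow.not_contact_of_concave hK hparabolic hK0 hK2 hH hH1 hH2 hHK ht₀ p₀ hε hmax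
    refine ⟨-M, ⟨⟨q, ?_⟩, ?_⟩, fun t ht p => neg_le.1 (hle t ht p)⟩
    · rw [← hq]
      simp
    · rintro _ ⟨p, rfl⟩
      exact neg_le.1 (hM ⟨p, rfl⟩)
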